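/- **Setting.** Let $L,H,\kappa,\varepsilon_+,\varepsilon_->0$, $\theta\in\mathbb R$, $\Omega=(0,L)\times(-H,H)$, $\Gamma_{\pm H}=(0,L)\times\{\pm H\}$. Let $\varepsilon:\mathbb R^2\to\mathbb C$ be measurable, $L$-periodic in $x_1$, with $\operatorname{Re}\varepsilon\ge c$ for some $c>0$, $\varepsilon=\varepsilon_+$ for $x_2>H$ and $\varepsilon=\varepsilon_-$ for $x_2<-H$. Let $u^{\rm inc}(x)=\exp[i\kappa\sqrt{\varepsilon_+}(x_1\sin\theta-x_2\cos\theta)]$, $\alpha_n=\kappa\sqrt{\varepsilon_+}\sin\theta+2\pi n/L$, and let $\beta_n^\pm=\sqrt{\kappa^2\varepsilon_\pm-\alpha_n^2}$ if $\alpha_n^2<\kappa^2\varepsilon_\pm$, $\beta_n^\pm=i\sqrt{\alpha_n^2-\kappa^2\varepsilon_\pm}$ otherwise. Let $-H=h_0<h_1<\dots<h_S=H$ and $\varepsilon_h(x_1,x_2)=\varepsilon(x_1,\tfrac12(h_{j-1}+h_j))$ for $h_{j-1}<x_2<h_j$, $1\le j\le S$. Let $H^1_{qp}(\Omega)$ be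 the closure in $H^1(\Omega)$ of the smooth functions with $\varphi(x_1+L,x_2)=e^{i\alpha_0L}\varphi(x_1,x_2)$. For $w,v\in H^1_{qp}(\Omega)$ put $$B_{\varepsilon_h}(w,v)=\int_\Omega\Big(\frac1{\varepsilon_h}\nabla w\cdot\nabla\overline v-\kappa^2w\overline v\Big)-\int_{\Gamma_{-H}}\overline v\,T^-w-\int_{\Gamma_H}\overline v\,T^+w,\qquad T^\pm\varphi=\frac{i}{\varepsilon_\pm}\sum_{n\in\mathbb Z}\beta_n^\pm\varphi_n e^{i\alpha_nx_1}$$ for $\varphi=\sum_n\varphi_ne^{i\alpha_nx_1}$, and $$f(v)=-\int_\Omega\nabla\cdot\big[(\varepsilon_+^{-1}-\varepsilon_h^{-1})\nabla u^{\rm inc}\big]\,\overline v ,$$ where the divergence is distributional and the permittivity beyond $\Gamma_{\pm H}$ is $\varepsilon_\pm$, i.e. $$f(v)=\int_\Omega(\varepsilon_+^{-1}-\varepsilon_h^{-1})\nabla u^{\rm inc}\cdot\nabla\overline v+\int_{\Gamma_{-H}}(\varepsilon_+^{-1}-\varepsilon_-^{-1})\,\frac{\partial u^{\rm inc}}{\partial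 x_2}\,\overline v .$$ For $M\ge0$ let $V_M=H^1(-H,H)\otimes\operatorname{span}\{e^{i\alpha_nx_1}:|n|\le M\}\subset H^1_{qp}(\Omega)$. **RCWA solution.** Let $c^{(j)}_k$ be the $k$-th Fourier coefficient of the $L$-periodic function $1/\varepsilon_h$ of $x_1$ in the slice $h_{j-1}<x_2<h_j$, let $f_n$ be the coefficient of $e^{i\alpha_nx_1}$ in $\nabla\cdot[(\varepsilon_+^{-1}-\varepsilon_h^{-1})\nabla u^{\rm inc}]$ inside a slice, and write $u^{\rm inc}=\sum_nu_n^{\rm inc}(x_2)e^{i\alpha_nx_1}$ (so $u^{\rm inc}_n=0$ for $n\ne0$). An RCWA solution is a function $u^{h,M}=\sum_{|n|\le M}u_n(x_2)e^{i\alpha_nx_1}$ with $u_n$ continuous on $[-H,H]$ and $C^2$ on each $[h_{j-1},h_j]$, such that for all $|n|\le M$: 1. in each slice, $\displaystyle\sum_{|m|\le M}c^{(j)}_{n-m}u_m''=\alpha_n\sum_{|m|\le M}c^{(j)}_{n-m}\alpha_mu_m-\kappa^2u_n+f_n$; 2. the total flux $\sum_{|m|\le M}c^{(j)}_{n-m}(u_m+u^{\rm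 inc}_m)'$ is continuous across $x_2=h_1,\dots,h_{S-1}$; 3. on $\Gamma_{H}$, respectively $\Gamma_{-H}$, the total field and the total flux are continuous with $u^{\rm inc}$ plus an outgoing expansion $\sum_{|n|\le M}r_ne^{i\beta_n^+(x_2-H)}e^{i\alpha_nx_1}$ in the medium $\varepsilon_+$, respectively $\sum_{|n|\le M}t_ne^{-i\beta_n^-(x_2+H)}e^{i\alpha_nx_1}$ in the medium $\varepsilon_-$; that is, $u_n(H)=r_n$, the total flux at $H$ is $\varepsilon_+^{-1}((u_n^{\rm inc})'(H)+i\beta_n^+r_n)$, $u_n(-H)=t_n$, and the total flux at $-H$ is $\varepsilon_-^{-1}((u_n^{\rm inc})'(-H)-i\beta_n^-t_n)$. **Theorem.** Every RCWA solution $u^{h,M}$ lies in $V_M$ and satisfies the Galerkin equations $$B_{\varepsilon_h}(u^{h,M},v_M)=f(v_M)\qquad\text{for all }v_M\in V_M .$$ -/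

import Mathlib

open MeasureTheory Filter Topology Complex
open scoped ContDiff ComplexConjugate

noncomputable section

namespace RCWA

/-- The data of the scattering problem. The period cell is `(0,L) × (-H,H)`, `κ` is the wavenumber,
`θ` the angle of incidence, `ε` the relative permittivity, which is the positive constant `εp`
above `x₂ = H` and the positive constant `εm` below `x₂ = -H`. The condition on the real part covers
real permittivities (bounded below by a positive number) as well as dissipative ones. -/
structure Grating where
  L : ℝ
  H : ℝ
  κ : ℝ
  θ : ℝ
  εp : ℝ
  εm : ℝ
  ε : ℝ × ℝ → ℂ
  L_pos : 0 < L
  H_pos : 0 < H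
  κ_pos : 0 < κ
  εp_pos : 0 < εp
  εm_pos : 0 < εm
  measurable_ε : Measurable ε
  periodic_ε : ∀ x₁ x₂ : ℝ, ε (x₁ + L, x₂) = ε (x₁, x₂)
  ε_above : ∀ x₁ x₂ : ℝ, H < x₂ → ε (x₁, x₂) = (εp : ℂ)
  ε_below : ∀ x₁ x₂ : ℝ, x₂ < -H → ε (x₁, x₂) = (εm : ℂ)
  re_ε : ∃ c : ℝ, 0 < c ∧ ∀ x, c ≤ (ε x).re

/-- A mesh `-H = h₀ < h₁ < ⋯ < h_S = H`; the slices are numbered `j = 0, …, S - 1`, slice `j` being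
`h_j < x₂ < h_{j+1}`. -/
structure Mesh (P : Grating) where
  S : ℕ
  node : ℕ → ℝ
  S_pos : 0 < S
  node_zero : node 0 = -P.H
  node_last : node S = P.H
  node_lt : ∀ j, j < S → node j < node (j + 1)

/-- Partial derivative in `x₁`. -/
def pd₁ (φ : ℝ × ℝ → ℂ) (x : ℝ × ℝ) : ℂ := deriv (fun s : ℝ => φ (s, x.2)) x.1

/-- Partial derivative in `x₂`. -/
def pd₂ (φ : ℝ × ℝ → ℂ) (x : ℝ × ℝ) : ℂ := deriv (fun t : ℝ => φ (x.1, t)) x.2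

variable (P : Grating)

/-- The domain `Ω` of one period. -/
def Omega : Set (ℝ × ℝ) := Set.Ioo 0 P.L ×ˢ Set.Ioo (-P.H) P.H

/-- Lebesgue measure on `Ω`. -/
def volΩ : Measure (ℝ × ℝ) := volume.restrict (Omega P)

/-- Lebesgue measure on `(0,L)`, i.e. on either of `Γ_H`, `Γ_{-H}`. -/
def volΓ : Measure ℝ := volume.restrict (Set.Ioo 0 P.L)

/-- `α_n = κ √ε₊ sin θ + 2πn/L`. -/
def α (n : ℤ) : ℝ := P.κ * √P.εp * Real.sin P.θ + n * (2 * Real.pi / P.L)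

/-- `β_n` for the half-space with constant permittivity `e`. -/
def β (e : ℝ) (n : ℤ) : ℂ :=
  if α P n ^ 2 < P.κ ^ 2 * e then (√(P.κ ^ 2 * e - α P n ^ 2) : ℂ)
  else I * (√(α P n ^ 2 - P.κ ^ 2 * e) : ℂ)

/-- The mode `exp(i α_n x₁)`. -/
def mode (n : ℤ) (x₁ : ℝ) : ℂ := exp (I * α P n * x₁)

/-- The `n`-th quasi-periodic Fourier coefficient: `φ = ∑ φ_n exp(i α_n x₁)`. -/
def qpCoeff (n : ℤ) (φ : ℝ → ℂ) : ℂ :=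
  (1 / (P.L : ℂ)) * ∫ x₁ in Set.Ioo 0 P.L, φ x₁ * exp (-(I * α P n * x₁))

/-- The incident plane wave. -/
def uinc (x : ℝ × ℝ) : ℂ :=
  exp (I * P.κ * (√P.εp : ℝ) * (x.1 * Real.sin P.θ - x.2 * Real.cos P.θ))

/-- Smooth functions that are quasi-periodic in `x₁`. -/
def IsSmoothQP (φ : ℝ × ℝ → ℂ) : Prop :=
  ContDiff ℝ ∞ φ ∧ ∀ x₁ x₂ : ℝ, φ (x₁ + P.L, x₂) = exp (I * α P 0 * P.L) * φ (x₁, x₂)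

/-- `H¹_qp(Ω)`, the closure of the smooth quasi-periodic functions in the `H¹(Ω)`-norm. An element is
given by a function `val`, its weak partial derivatives `d₁`, `d₂` and its traces `top`, `bot`
on `Γ_H`, `Γ_{-H}`. These four are determined almost everywhere by `val`, and, the trace operator
being continuous, the convergence of the traces follows from that in the `H¹`-norm. -/
structure H1qp where
  val : ℝ × ℝ → ℂ
  d₁ : ℝ × ℝ → ℂ
  d₂ : ℝ × ℝ → ℂ
  top : ℝ → ℂ
  bot : ℝ → ℂ
  memLp_val : MemLp val 2 (volΩ P)
  memLp_d₁ : MemLp d₁ 2 (volΩ P)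
  memLp_d₂ : MemLp d₂ 2 (volΩ P)
  memLp_top : MemLp top 2 (volΓ P)
  memLp_bot : MemLp bot 2 (volΓ P)
  approx : ∃ φ : ℕ → ℝ × ℝ → ℂ, (∀ k, IsSmoothQP P (φ k)) ∧
    Tendsto (fun k => eLpNorm (φ k - val) 2 (volΩ P)) atTop (𝓝 0) ∧
    Tendsto (fun k => eLpNorm (pd₁ (φ k) - d₁) 2 (volΩ P)) atTop (𝓝 0) ∧
    Tendsto (fun k => eLpNorm (pd₂ (φ k) - d₂) 2 (volΩ P)) atTop (𝓝 0) ∧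
    Tendsto (fun k => eLpNorm ((fun x₁ => φ k (x₁, P.H)) - top) 2 (volΓ P)) atTop (𝓝 0) ∧
    Tendsto (fun k => eLpNorm ((fun x₁ => φ k (x₁, -P.H)) - bot) 2 (volΓ P)) atTop (𝓝 0)

/-- The pairing `∫_Γ conj(ψ) T(φ)` with the Dirichlet-to-Neumann operator
`T φ = (i/e) ∑ φ_n β_n exp(i α_n x₁)` of the half-space of permittivity `e`, as the duality between
`H^{-1/2}` and `H^{1/2}` (the series `T φ` need not converge to a function). -/
def dtnPairing (e : ℝ) (φ ψ : ℝ → ℂ) : ℂ :=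
  P.L * ∑' n : ℤ, (I / e) * β P e n * qpCoeff P n φ * conj (qpCoeff P n ψ)

/-- The sesquilinear form `B_e` for a permittivity `e` in `Ω`. -/
def B (e : ℝ × ℝ → ℂ) (w v : H1qp P) : ℂ :=
  (∫ x in Omega P, ((1 / e x) * (w.d₁ x * conj (v.d₁ x) + w.d₂ x * conj (v.d₂ x))
      - (P.κ : ℂ) ^ 2 * (w.val x * conj (v.val x))))
    - dtnPairing P P.εm w.bot v.bot - dtnPairing P P.εp w.top v.top

/-- The functional `v ↦ -∫_Ω ∇·[(ε₊⁻¹ - e⁻¹) ∇u^inc] conj(v)`. As `e` may jump, the divergence is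
that of a distribution and the integral is understood by the divergence theorem. Since the
permittivity beyond `Γ_H`, `Γ_{-H}` is `ε₊`, `ε₋`, these are its values in the boundary terms
(so that the one on `Γ_H` is zero). -/
def source (e : ℝ × ℝ → ℂ) (v : H1qp P) : ℂ :=
  (∫ x in Omega P, (1 / (P.εp : ℂ) - 1 / e x) *
      (pd₁ (uinc P) x * conj (v.d₁ x) + pd₂ (uinc P) x * conj (v.d₂ x)))
    - (∫ x₁ in Set.Ioo 0 P.L,
        (1 / (P.εp : ℂ) - 1 / (P.εp : ℂ)) * pd₂ (uinc P) (x₁, P.H) * conj (v.top x₁))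
    + ∫ x₁ in Set.Ioo 0 P.L,
        (1 / (P.εp : ℂ) - 1 / (P.εm : ℂ)) * pd₂ (uinc P) (x₁, -P.H) * conj (v.bot x₁)

/-- `H¹(-H,H)`: square-integrable with a square-integrable weak derivative. -/
def MemH1Interval (ξ : ℝ → ℂ) : Prop :=
  MemLp ξ 2 (volume.restrict (Set.Ioo (-P.H) P.H)) ∧
  ∃ ξ' : ℝ → ℂ, MemLp ξ' 2 (volume.restrict (Set.Ioo (-P.H) P.H)) ∧
    ∀ η : ℝ → ℂ, ContDiff ℝ ∞ η → HasCompactSupport η → tsupport η ⊆ Set.Ioo (-P.H) P.H →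
      ∫ t in Set.Ioo (-P.H) P.H, ξ t * deriv η t = -∫ t in Set.Ioo (-P.H) P.H, ξ' t * η t

/-- `E_M = span {exp(i α_n x₁) : -M ≤ n ≤ M}`. -/
def E (M : ℕ) : Submodule ℂ (ℝ → ℂ) :=
  Submodule.span ℂ (mode P '' Set.Icc (-(M : ℤ)) M)

/-- `V_M = H¹(-H,H) ⊗ E_M` inside `H¹_qp(Ω)`. -/
def V (M : ℕ) : Set (H1qp P) :=
  {v | ∃ g ∈ Submodule.span ℂ {g : ℝ × ℝ → ℂ | ∃ ξ e : ℝ → ℂ, MemH1Interval P ξ ∧ e ∈ E P M ∧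
      g = fun x => ξ x.2 * e x.1}, v.val =ᵐ[volΩ P] g}

variable {P}
variable (T : Mesh P)

/-- The permittivity in slice `j`, sampled on its centre line. -/
def Mesh.sliceε (j : ℕ) (x₁ : ℝ) : ℂ := P.ε (x₁, (T.node j + T.node (j + 1)) / 2)

open Classical in
/-- The stairstep approximation `ε_h` of `ε` (the value `0` on the lines `x₂ = h_j`, a null set, is
immaterial). -/
def Mesh.εh (x : ℝ × ℝ) : ℂ :=
  ∑ j ∈ Finset.range T.S,
    if x.2 ∈ Set.Ioo (T.node j) (T.node (j + 1)) then T.sliceε j x.1 else 0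

/-- The `k`-th Fourier coefficient of the `L`-periodic function `1/ε_h` in slice `j`. -/
def Mesh.invεCoeff (j : ℕ) (k : ℤ) : ℂ :=
  (1 / (P.L : ℂ)) * ∫ x₁ in Set.Ioo 0 P.L,
    (1 / T.sliceε j x₁) * exp (-(I * (k * (2 * Real.pi / P.L) : ℝ) * x₁))

/-- The `n`-th Fourier coefficient in slice `j` of `f = ∇·[(ε₊⁻¹ - ε_h⁻¹) ∇u^inc]`. -/
def Mesh.sourceCoeff (j : ℕ) (n : ℤ) (x₂ : ℝ) : ℂ :=
  I * α P n * qpCoeff P n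
      (fun x₁ => (1 / (P.εp : ℂ) - 1 / T.sliceε j x₁) * pd₁ (uinc P) (x₁, x₂))
    + deriv (fun t : ℝ => qpCoeff P n
      (fun x₁ => (1 / (P.εp : ℂ) - 1 / T.sliceε j x₁) * pd₂ (uinc P) (x₁, t))) x₂

variable (P) in
/-- The coefficient functions of the incident field, `u^inc = ∑ u^inc_n(x₂) exp(i α_n x₁)`. -/
def incCoeff (n : ℤ) (x₂ : ℝ) : ℂ :=
  if n = 0 then exp (-(I * P.κ * (√P.εp : ℝ) * Real.cos P.θ * x₂)) else 0

/-- The coefficients of the truncated conormal derivative `ε_h⁻¹ ∂₂u^t` of the total field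
`u^t = u + u^inc` in slice `j` (one-sided derivatives at its ends). -/
def Mesh.totalFlux (M : ℕ) (u : ℤ → ℝ → ℂ) (j : ℕ) (n : ℤ) (x₂ : ℝ) : ℂ :=
  ∑ m ∈ Finset.Icc (-(M : ℤ)) M, T.invεCoeff j (n - m) *
    derivWithin (fun t => u m t + incCoeff P m t) (Set.Icc (T.node j) (T.node (j + 1))) x₂

variable (P) in
/-- The field `∑_{|n| ≤ M} u_n(x₂) exp(i α_n x₁)`. -/
def field (M : ℕ) (u : ℤ → ℝ → ℂ) (x : ℝ × ℝ) : ℂ :=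
  ∑ n ∈ Finset.Icc (-(M : ℤ)) M, u n x.2 * mode P n x.1

/-- `u_n`, `-M ≤ n ≤ M`, are the coefficient functions of the (scattered field) RCWA solution, `r`
and `t` the coefficients of the outgoing Rayleigh–Bloch expansions
`∑ r_n exp(i β_n⁺ (x₂ - H)) exp(i α_n x₁)` above `Γ_H` and
`∑ t_n exp(-i β_n⁻ (x₂ + H)) exp(i α_n x₁)` below `Γ_{-H}`. The ordinary differential equations hold
in the slices; the total field and its conormal derivative are continuous across
the lines between the slices and across `Γ_H`, `Γ_{-H}`. -/
structure Mesh.IsSolution (M : ℕ) (u : ℤ → ℝ → ℂ) (r t : ℤ → ℂ) : Prop where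
  continuousOn : ∀ n ∈ Finset.Icc (-(M : ℤ)) M, ContinuousOn (u n) (Set.Icc (-P.H) P.H)
  contDiffOn : ∀ n ∈ Finset.Icc (-(M : ℤ)) M, ∀ j < T.S,
    ContDiffOn ℝ 2 (u n) (Set.Icc (T.node j) (T.node (j + 1)))
  ode : ∀ n ∈ Finset.Icc (-(M : ℤ)) M, ∀ j < T.S,
    ∀ x₂ ∈ Set.Ioo (T.node j) (T.node (j + 1)),
      ∑ m ∈ Finset.Icc (-(M : ℤ)) M, T.invεCoeff j (n - m) * deriv (deriv (u m)) x₂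
        = α P n * ∑ m ∈ Finset.Icc (-(M : ℤ)) M, T.invεCoeff j (n - m) * (α P m * u m x₂)
          - (P.κ : ℂ) ^ 2 * u n x₂ + T.sourceCoeff j n x₂
  flux : ∀ n ∈ Finset.Icc (-(M : ℤ)) M, ∀ j, j + 1 < T.S →
    T.totalFlux M u j n (T.node (j + 1)) = T.totalFlux M u (j + 1) n (T.node (j + 1))
  top_val : ∀ n ∈ Finset.Icc (-(M : ℤ)) M,
    u n P.H + incCoeff P n P.H = incCoeff P n P.H + r n
  top_flux : ∀ n ∈ Finset.Icc (-(M : ℤ)) M,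
    T.totalFlux M u (T.S - 1) n P.H
      = (1 / (P.εp : ℂ)) * (deriv (incCoeff P n) P.H + I * β P P.εp n * r n)
  bot_val : ∀ n ∈ Finset.Icc (-(M : ℤ)) M,
    u n (-P.H) + incCoeff P n (-P.H) = incCoeff P n (-P.H) + t n
  bot_flux : ∀ n ∈ Finset.Icc (-(M : ℤ)) M,
    T.totalFlux M u 0 n (-P.H)
      = (1 / (P.εm : ℂ)) * (deriv (incCoeff P n) (-P.H) - I * β P P.εm n * t n)

end RCWA

end

/-
Put `σ = ε_h⁻¹ ∇(u + u^inc) - ε₊⁻¹ ∇u^inc`. Up to boundary terms, `B(u, v) - f(v)` is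
`∫_Ω σ · ∇v̄ - κ² u v̄`, and for `v = ∑_{|n| ≤ M} ξ_n(x₂) exp(i α_n x₁)` orthogonality of the modes
leaves only the Fourier coefficients of `σ` and `u` with `|n| ≤ M`. By Laurent's rule these are the
quantities occurring in the RCWA equations: the ordinary differential equations say
`i α_n σ₁ₙ + σ₂ₙ' = -κ² u_n` in each slice, and the interface conditions say that `σ₂ₙ` is
continuous on `[-H, H]`. One integration by parts in `x₂` thus leaves the values of `σ₂ₙ` at
`x₂ = ±H`, and the radiation conditions turn them into the Dirichlet-to-Neumann terms and the
boundary term of `f`.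

An element of `V_M` is given only up to null sets, so its weak derivatives and traces must be
related to the coefficients `ξ_n`. The integration by parts is therefore carried out on the smooth
functions that approximate `v`, where the traces are boundary values, and passed to the limit.
-/

noncomputable section

namespace RCWA

section LpTwo

variable {X : Type*} [MeasurableSpace X] {μ : Measure X}

lemma integrable_mul_conj_of_memLp_two {f g : X → ℂ} (hf : MemLp f 2 μ) (hg : MemLp g 2 μ) :
    Integrable (fun x => f x * conj (g x)) μ :=
  hf.integrable_mul hg.star

lemma tendsto_integral_mul_of_tendsto_eLpNorm_two {G f : X → ℂ} {φ : ℕ → X → ℂ}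
    (hG : MemLp G 2 μ) (hf : MemLp f 2 μ) (hφ : ∀ k, MemLp (φ k) 2 μ)
    (h : Tendsto (fun k => eLpNorm (φ k - f) 2 μ) atTop (𝓝 0)) :
    Tendsto (fun k => ∫ x, G x * φ k x ∂μ) atTop (𝓝 (∫ x, G x * f x ∂μ)) := by
  have hbound : Tendsto (fun k => eLpNorm G 2 μ * eLpNorm (φ k - f) 2 μ) atTop (𝓝 0) := by
    simpa only [mul_zero] using ENNReal.Tendsto.const_mul h (Or.inr hG.eLpNorm_ne_top)
  refine tendsto_integral_of_L1' _ (hG.integrable_mul hf).1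
    (Eventually.of_forall fun k => hG.integrable_mul (hφ k))
    (tendsto_of_tendsto_of_tendsto_of_le_of_le tendsto_const_nhds hbound (fun _ => zero_le)
      fun k => ?_)
  have hHolder := eLpNorm_smul_le_mul_eLpNorm (p := 2) (q := 2) (r := 1) ((hφ k).sub hf).1 hG.1
  rwa [smul_eq_mul, mul_sub] at hHolder

lemma tendsto_integral_mul_conj_of_tendsto_eLpNorm_two {G f : X → ℂ} {φ : ℕ → X → ℂ}
    (hG : MemLp G 2 μ) (hf : MemLp f 2 μ) (hφ : ∀ k, MemLp (φ k) 2 μ)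
    (h : Tendsto (fun k => eLpNorm (φ k - f) 2 μ) atTop (𝓝 0)) :
    Tendsto (fun k => ∫ x, G x * conj (φ k x) ∂μ) atTop (𝓝 (∫ x, G x * conj (f x) ∂μ)) := by
  refine tendsto_integral_mul_of_tendsto_eLpNorm_two hG hf.star (fun k => (hφ k).star)
    (h.congr fun k => ?_)
  exact (eLpNorm_star (f := φ k - f)).symm.trans (by rw [star_sub]; rfl)

end LpTwo

section WeakDerivative

variable {E : Type*} [NormedAddCommGroup E]

lemma integrable_mul_of_hasCompactSupport [MeasurableSpace E] [OpensMeasurableSpace E]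
    {μ : Measure E} {η f : E → ℂ} (hη : Continuous η) (hc : HasCompactSupport η)
    (hf : Integrable f μ) : Integrable (fun x => η x * f x) μ := by
  obtain ⟨C, hC⟩ := hc.exists_bound_of_continuous hη
  exact hf.bdd_mul hη.aestronglyMeasurable (Eventually.of_forall hC)

variable [NormedSpace ℝ E]

lemma continuous_fderiv_apply {η : E → ℂ} (hη : ContDiff ℝ 1 η) (w : E) :
    Continuous fun x => fderiv ℝ η x w :=
  (hη.continuous_fderiv one_ne_zero).clm_apply continuous_const

variable [MeasureSpace E]

/-- `g` is the weak derivative of `f` in the direction `w` on the set `U`: the divergence theorem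
holds for every complex test function supported in `U`. -/
def HasWeakLineDerivOn (f g : E → ℂ) (w : E) (U : Set E) : Prop :=
  ∀ η : E → ℂ, ContDiff ℝ ∞ η → HasCompactSupport η → tsupport η ⊆ U →
    ∫ x in U, fderiv ℝ η x w * f x = -∫ x in U, η x * g x

variable {f f' g g' : E → ℂ} {w : E} {U : Set E}

namespace HasWeakLineDerivOn

lemma congr_left (h : HasWeakLineDerivOn f g w U) (hff' : f =ᵐ[volume.restrict U] f') :
    HasWeakLineDerivOn f' g w U := fun η hη hc hs =>
  (integral_congr_ae (hff'.mono fun x hx => by simp only [hx])).symm.trans (h η hη hc hs)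

lemma const_mul (h : HasWeakLineDerivOn f g w U) (c : ℂ) :
    HasWeakLineDerivOn (fun x => c * f x) (fun x => c * g x) w U := fun η hη hc hs => by
  simp only [mul_left_comm _ c, integral_const_mul, h η hη hc hs, mul_neg]

variable [BorelSpace E]

lemma sum {ι : Type*} {s : Finset ι} {f g : ι → E → ℂ}
    (h : ∀ i ∈ s, HasWeakLineDerivOn (f i) (g i) w U) (hf : ∀ i ∈ s, IntegrableOn (f i) U)
    (hg : ∀ i ∈ s, IntegrableOn (g i) U) :
    HasWeakLineDerivOn (fun x => ∑ i ∈ s, f i x) (fun x => ∑ i ∈ s, g i x) w U := by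
  intro η hη hc hs
  have hη' := continuous_fderiv_apply (hη.of_le (by simp)) w
  simp only [Finset.mul_sum]
  rw [integral_finsetSum _ fun i hi =>
      integrable_mul_of_hasCompactSupport hη' (hc.fderiv_apply ℝ w) (hf i hi),
    integral_finsetSum _ fun i hi => integrable_mul_of_hasCompactSupport hη.continuous hc (hg i hi),
    Finset.sum_congr rfl fun i hi => h i hi η hη hc hs, Finset.sum_neg_distrib]

lemma add (h : HasWeakLineDerivOn f g w U) (h' : HasWeakLineDerivOn f' g' w U)
    (hf : IntegrableOn f U) (hf' : IntegrableOn f' U) (hg : IntegrableOn g U)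
    (hg' : IntegrableOn g' U) :
    HasWeakLineDerivOn (fun x => f x + f' x) (fun x => g x + g' x) w U := by
  simpa using sum (s := Finset.univ) (f := ![f, f']) (g := ![g, g']) (w := w) (U := U)
    (by simp [Fin.forall_fin_two, h, h']) (by simp [Fin.forall_fin_two, hf, hf'])
    (by simp [Fin.forall_fin_two, hg, hg'])

lemma of_tendsto [IsFiniteMeasureOnCompacts (volume : Measure E)] {φ ψ : ℕ → E → ℂ}
    (h : ∀ k, HasWeakLineDerivOn (φ k) (ψ k) w U)
    (hf : MemLp f 2 (volume.restrict U)) (hφ : ∀ k, MemLp (φ k) 2 (volume.restrict U))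
    (hφf : Tendsto (fun k => eLpNorm (φ k - f) 2 (volume.restrict U)) atTop (𝓝 0))
    (hg : MemLp g 2 (volume.restrict U)) (hψ : ∀ k, MemLp (ψ k) 2 (volume.restrict U))
    (hψg : Tendsto (fun k => eLpNorm (ψ k - g) 2 (volume.restrict U)) atTop (𝓝 0)) :
    HasWeakLineDerivOn f g w U := by
  intro η hη hc hs
  have hη' := continuous_fderiv_apply (hη.of_le (by simp)) w
  have hl := tendsto_integral_mul_of_tendsto_eLpNorm_two
    ((hη'.memLp_of_hasCompactSupport (hc.fderiv_apply ℝ w)).restrict U) hf hφ hφf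
  have hr := tendsto_integral_mul_of_tendsto_eLpNorm_two
    ((hη.continuous.memLp_of_hasCompactSupport hc).restrict U) hg hψ hψg
  exact tendsto_nhds_unique hl (hr.neg.congr fun k => (h k η hη hc hs).symm)

variable [FiniteDimensional ℝ E]

lemma of_contDiff [(volume : Measure E).IsAddHaarMeasure] (hf : ContDiff ℝ 1 f) (w : E)
    (U : Set E) : HasWeakLineDerivOn f (fun x => fderiv ℝ f x w) w U := by
  intro η hη hc hs
  have hη' := continuous_fderiv_apply (hη.of_le (by simp)) w
  have hparts := integral_mul_fderiv_eq_neg_fderiv_mul_of_integrable (μ := volume) (v := w)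
    ((hη'.mul hf.continuous).integrable_of_hasCompactSupport (hc.fderiv_apply ℝ w).mul_right)
    ((hη.continuous.mul (continuous_fderiv_apply hf w)).integrable_of_hasCompactSupport
      hc.mul_right)
    ((hη.continuous.mul hf.continuous).integrable_of_hasCompactSupport hc.mul_right)
    (fun x _ => hη.differentiable (by simp) x) (fun x _ => hf.differentiable one_ne_zero x)
  rw [setIntegral_eq_integral_of_forall_compl_eq_zero,
    setIntegral_eq_integral_of_forall_compl_eq_zero, hparts, neg_neg]
  · intro x hx
    rw [image_eq_zero_of_notMem_tsupport (mt (@hs x) hx), zero_mul]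
  · intro x hx
    rw [image_eq_zero_of_notMem_tsupport (f := fderiv ℝ η) fun h =>
      hx (hs (tsupport_fderiv_subset ℝ h)), zero_apply, zero_mul]

lemma ae_eq (h : HasWeakLineDerivOn f g w U) (h' : HasWeakLineDerivOn f g' w U) (hU : IsOpen U)
    (hg : IntegrableOn g U) (hg' : IntegrableOn g' U) : g =ᵐ[volume.restrict U] g' := by
  have hzero := hU.ae_eq_zero_of_integral_contDiff_smul_eq_zero
    (hg.sub hg').locallyIntegrableOn fun η hη hc hs => ?_
  · rw [EventuallyEq, ae_restrict_iff' hU.measurableSet]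
    exact hzero.mono fun x hx hxU => sub_eq_zero.1 (hx hxU)
  have hη' : ContDiff ℝ ∞ fun x => (η x : ℂ) := ofRealCLM.contDiff.comp hη
  have hc' : HasCompactSupport fun x => (η x : ℂ) := hc.comp_left ofReal_zero
  have hs' : tsupport (fun x => (η x : ℂ)) ⊆ U :=
    (closure_mono fun x hx => by simpa using hx).trans hs
  rw [← setIntegral_eq_integral_of_forall_compl_eq_zero (s := U) fun x hx => by
    rw [image_eq_zero_of_notMem_tsupport (mt (@hs x) hx), zero_smul]]
  simp only [Pi.sub_apply, real_smul, mul_sub]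
  rw [integral_sub (integrable_mul_of_hasCompactSupport hη'.continuous hc' hg)
    (integrable_mul_of_hasCompactSupport hη'.continuous hc' hg'), sub_eq_zero, ← neg_inj,
    ← h _ hη' hc' hs', ← h' _ hη' hc' hs']

end HasWeakLineDerivOn

end WeakDerivative

section ChangeOfVariables

variable {E F : Type*} [NormedAddCommGroup E] [NormedSpace ℝ E] [MeasureSpace E]
  [NormedAddCommGroup F] [NormedSpace ℝ F] [MeasureSpace F] [BorelSpace E] [BorelSpace F]

lemma HasWeakLineDerivOn.comp_measurePreserving {f g : F → ℂ} {w : E} {U : Set F} (A : E ≃L[ℝ] F)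
    (hA : MeasurePreserving A) (h : HasWeakLineDerivOn f g (A w) U) :
    HasWeakLineDerivOn (f ∘ A) (g ∘ A) w (A ⁻¹' U) := by
  intro η hη hc hs
  have hemb := A.toHomeomorph.measurableEmbedding
  have hsupp : tsupport (η ∘ A.symm) ⊆ U :=
    (tsupport_comp_subset_preimage η A.symm.continuous).trans fun y hy => by
      simpa using hs hy
  have key := h (η ∘ A.symm) (hη.comp A.symm.contDiff)
    (hc.comp_homeomorph A.symm.toHomeomorph) hsupp
  rw [← hA.setIntegral_preimage_emb hemb, ← hA.setIntegral_preimage_emb hemb] at key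
  simpa [A.symm.comp_right_fderiv] using key

end ChangeOfVariables

section Product

variable {E₁ E₂ : Type*} [NormedAddCommGroup E₁] [NormedSpace ℝ E₁] [MeasureSpace E₁]
  [NormedAddCommGroup E₂] [NormedSpace ℝ E₂] [MeasureSpace E₂] [BorelSpace E₁] [BorelSpace E₂]
  [SecondCountableTopology E₂]
  [SFinite (volume : Measure E₁)] [SFinite (volume : Measure E₂)]
  {e e' : E₁ → ℂ} {ξ ξ' : E₂ → ℂ} {U₁ : Set E₁} {U₂ : Set E₂}

lemma HasWeakLineDerivOn.comp_snd_mul {w : E₂} (h : HasWeakLineDerivOn ξ ξ' w U₂)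
    (hξ : IntegrableOn ξ U₂) (hξ' : IntegrableOn ξ' U₂) (he : IntegrableOn e U₁) :
    HasWeakLineDerivOn (fun x : E₁ × E₂ => ξ x.2 * e x.1) (fun x => ξ' x.2 * e x.1) (0, w)
      (U₁ ×ˢ U₂) := by
  intro η hη hc hs
  have hη' := continuous_fderiv_apply (hη.of_le (by simp)) ((0 : E₁), w)
  have hl := integrable_mul_of_hasCompactSupport hη' (hc.fderiv_apply ℝ _) (he.mul_prod hξ)
  have hr := integrable_mul_of_hasCompactSupport hη.continuous hc (he.mul_prod hξ')
  simp only [mul_comm (e _)] at hl hr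
  rw [Measure.volume_eq_prod, ← Measure.prod_restrict, integral_prod _ hl, integral_prod _ hr,
    ← integral_neg]
  refine integral_congr_ae (Eventually.of_forall fun x => ?_)
  have hemb : IsClosedEmbedding fun y : E₂ => (x, y) :=
    Function.LeftInverse.isClosedEmbedding (f := Prod.snd) (fun _ => rfl) continuous_snd
      (by fun_prop)
  have hslice := h (fun y => η (x, y)) (hη.comp (contDiff_prodMk_right x))
    (hc.comp_isClosedEmbedding hemb)
    ((tsupport_comp_subset_preimage η hemb.continuous).trans fun y hy => (hs hy).2)
  have hderiv (y : E₂) : fderiv ℝ (fun y => η (x, y)) y w = fderiv ℝ η (x, y) (0, w) := by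
    have hchain := ((hη.differentiable (by simp) (x, y)).hasFDerivAt.comp y
      (hasFDerivAt_prodMk_right x y)).fderiv
    simpa [Function.comp_def] using congr($hchain w)
  simp only [hderiv] at hslice
  simp only [← mul_assoc, integral_mul_const, hslice, neg_mul]

lemma HasWeakLineDerivOn.mul_comp_fst [SecondCountableTopology E₁] {w : E₁}
    (h : HasWeakLineDerivOn e e' w U₁)
    (he : IntegrableOn e U₁) (he' : IntegrableOn e' U₁) (hξ : IntegrableOn ξ U₂) :
    HasWeakLineDerivOn (fun x : E₁ × E₂ => ξ x.2 * e x.1) (fun x => ξ x.2 * e' x.1) (w, 0)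
      (U₁ ×ˢ U₂) := by
  have hswap := (h.comp_snd_mul he he' hξ).comp_measurePreserving (w := (w, 0))
    (ContinuousLinearEquiv.prodComm ℝ E₁ E₂) Measure.measurePreserving_swap
  have hU : ContinuousLinearEquiv.prodComm ℝ E₁ E₂ ⁻¹' U₂ ×ˢ U₁ = U₁ ×ˢ U₂ :=
    Set.preimage_swap_prod _ _
  simp only [mul_comm (ξ _)]
  rwa [hU] at hswap

end Product

section Interval

lemma memLp_restrict_of_continuousOn {X E : Type*} [TopologicalSpace X] [MeasurableSpace X]
    [OpensMeasurableSpace X] [NormedAddCommGroup E] [SecondCountableTopologyEither X E]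
    {μ : Measure X} [IsFiniteMeasureOnCompacts μ] {p : ENNReal} {f : X → E} {s K : Set X}
    (hf : ContinuousOn f K) (hK : IsCompact K) (hs : MeasurableSet s) (hsK : s ⊆ K) :
    MemLp f p (μ.restrict s) := by
  have : Fact (μ s < ⊤) := ⟨(measure_mono hsK).trans_lt hK.measure_lt_top⟩
  obtain ⟨C, hC⟩ := hK.exists_bound_of_continuousOn hf
  exact MemLp.of_bound ((hf.mono hsK).aestronglyMeasurable hs) C
    ((ae_restrict_mem hs).mono fun x hx => hC x (hsK hx))

lemma exists_contDiff_tendsto_eLpNorm_two {f : ℝ → ℂ} {μ : Measure ℝ}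
    [IsFiniteMeasureOnCompacts μ] (hf : MemLp f 2 μ) :
    ∃ g : ℕ → ℝ → ℂ, (∀ k, ContDiff ℝ ∞ (g k)) ∧
      Tendsto (fun k => eLpNorm (g k - f) 2 μ) atTop (𝓝 0) := by
  choose g _ hg hgf using fun k : ℕ =>
    hf.exist_eLpNorm_sub_le ENNReal.ofNat_ne_top one_le_two
      (Nat.one_div_pos_of_nat (α := ℝ) (n := k))
  refine ⟨g, hg, tendsto_of_tendsto_of_tendsto_of_le_of_le tendsto_const_nhds ?_
    (fun _ => zero_le) fun k => (eLpNorm_sub_comm _ _ _ _).trans_le (hgf k)⟩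
  simpa using ENNReal.tendsto_ofReal (tendsto_one_div_add_atTop_nhds_zero_nat (𝕜 := ℝ))

/-- `F` is the absolutely continuous representative of a function in `H¹(a,b)`, and `f` is its
derivative in `L²(a,b)`. -/
structure HasL2DerivOn (F f : ℝ → ℂ) (a b : ℝ) : Prop where
  memLp_deriv : MemLp f 2 (volume.restrict (Set.Ioo a b))
  eq_add_integral : ∀ x ∈ Set.Icc a b, F x = F a + ∫ s in a..x, f s

namespace HasL2DerivOn

variable {F G f g : ℝ → ℂ} {a b c : ℝ}

lemma of_contDiffOn (hF : ContDiffOn ℝ 1 F (Set.Icc a b)) : HasL2DerivOn F (deriv F) a b := by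
  rcases le_or_gt b a with hab | hab
  · refine ⟨by simp [Set.Ioo_eq_empty hab.not_gt], fun x hx => ?_⟩
    obtain rfl : x = a := le_antisymm (hx.2.trans hab) hx.1
    simp
  have hderivWithin (x : ℝ) (hx : x ∈ Set.Ioo a b) : derivWithin F (Set.Icc a b) x = deriv F x :=
    derivWithin_of_mem_nhds (Icc_mem_nhds hx.1 hx.2)
  have hderiv (x : ℝ) (hx : x ∈ Set.Ioo a b) : HasDerivAt F (deriv F x) x :=
    ((hF.differentiableOn one_ne_zero).differentiableAt (Icc_mem_nhds hx.1 hx.2)).hasDerivAt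
  have hL2 : MemLp (deriv F) 2 (volume.restrict (Set.Ioo a b)) :=
    (memLp_restrict_of_continuousOn (hF.continuousOn_derivWithin (uniqueDiffOn_Icc hab) le_rfl)
      isCompact_Icc measurableSet_Ioo Set.Ioo_subset_Icc_self).ae_eq
      ((ae_restrict_mem measurableSet_Ioo).mono hderivWithin)
  refine ⟨hL2, fun x hx => ?_⟩
  rw [intervalIntegral.integral_eq_sub_of_hasDerivAt_of_le hx.1
    (hF.continuousOn.mono (Set.Icc_subset_Icc_right hx.2))
    fun y hy => hderiv y ⟨hy.1, hy.2.trans_le hx.2⟩, add_sub_cancel]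
  rw [intervalIntegrable_iff_integrableOn_Ioo_of_le hx.1]
  exact (hL2.integrable one_le_two).mono_measure
    (Measure.restrict_mono (Set.Ioo_subset_Ioo_right hx.2) le_rfl)

lemma of_contDiff (hF : ContDiff ℝ 1 F) (a b : ℝ) : HasL2DerivOn F (deriv F) a b :=
  of_contDiffOn hF.contDiffOn

lemma intervalIntegrable (hF : HasL2DerivOn F f a b) {x : ℝ} (hx : x ∈ Set.Icc a b) :
    IntervalIntegrable f volume a x := by
  rw [intervalIntegrable_iff_integrableOn_Ioo_of_le hx.1]
  exact (hF.memLp_deriv.integrable one_le_two).mono_measure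
    (Measure.restrict_mono (Set.Ioo_subset_Ioo_right hx.2) le_rfl)

lemma continuousOn (hF : HasL2DerivOn F f a b) : ContinuousOn F (Set.Icc a b) := by
  rcases lt_or_ge b a with hab | hab
  · simp [Set.Icc_eq_empty hab.not_ge]
  have hcont := intervalIntegral.continuousOn_primitive_interval
    ((hF.intervalIntegrable (Set.right_mem_Icc.2 hab)).1.congr_set_ae (by
      rw [Set.uIcc_of_le hab]; exact Ioc_ae_eq_Icc.symm))
  rw [Set.uIcc_of_le hab] at hcont
  exact (hcont.const_add (F a)).congr hF.eq_add_integral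

lemma memLp (hF : HasL2DerivOn F f a b) : MemLp F 2 (volume.restrict (Set.Ioo a b)) :=
  memLp_restrict_of_continuousOn hF.continuousOn isCompact_Icc measurableSet_Ioo
    Set.Ioo_subset_Icc_self

lemma sub (hF : HasL2DerivOn F f a b) (hG : HasL2DerivOn G g a b) :
    HasL2DerivOn (F - G) (f - g) a b := by
  refine ⟨hF.memLp_deriv.sub hG.memLp_deriv, fun x hx => ?_⟩
  simp only [Pi.sub_apply]
  rw [intervalIntegral.integral_sub (hF.intervalIntegrable hx) (hG.intervalIntegrable hx),
    hF.eq_add_integral x hx, hG.eq_add_integral x hx]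
  ring

lemma trans (hF : HasL2DerivOn F f a b) (hF' : HasL2DerivOn F f b c) (hab : a ≤ b) (hbc : b ≤ c) :
    HasL2DerivOn F f a c := by
  refine ⟨?_, fun x hx => ?_⟩
  · have h := hF.memLp_deriv
    have h' := hF'.memLp_deriv
    rw [Measure.restrict_congr_set Ioo_ae_eq_Ioc] at h h' ⊢
    rw [← Set.Ioc_union_Ioc_eq_Ioc hab hbc]
    have hmeas := aestronglyMeasurable_union_iff.2 ⟨h.1, h'.1⟩
    rw [memLp_two_iff_integrable_sq_norm hmeas]
    exact IntegrableOn.union ((memLp_two_iff_integrable_sq_norm h.1).1 h)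
      ((memLp_two_iff_integrable_sq_norm h'.1).1 h')
  · rcases le_total x b with hxb | hbx
    · exact hF.eq_add_integral x ⟨hx.1, hxb⟩
    · rw [hF'.eq_add_integral x ⟨hbx, hx.2⟩, hF.eq_add_integral b (Set.right_mem_Icc.2 hab),
        add_assoc, intervalIntegral.integral_add_adjacent_intervals
          (hF.intervalIntegrable (Set.right_mem_Icc.2 hab)) (hF'.intervalIntegrable ⟨hbx, hx.2⟩)]

lemma enorm_le (hF : HasL2DerivOn F f a b) (ha : F a = 0) {x : ℝ} (hx : x ∈ Set.Icc a b) :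
    ‖F x‖ₑ ≤ eLpNorm f 2 (volume.restrict (Set.Ioo a b)) *
      volume.restrict (Set.Ioo a b) Set.univ ^ (1 / 2 : ℝ) := by
  rw [hF.eq_add_integral x hx, ha, zero_add, intervalIntegral.integral_of_le hx.1,
    integral_Ioc_eq_integral_Ioo]
  calc ‖∫ s in Set.Ioo a x, f s‖ₑ
      ≤ ∫⁻ s in Set.Ioo a x, ‖f s‖ₑ := enorm_integral_le_lintegral_enorm _
    _ ≤ ∫⁻ s in Set.Ioo a b, ‖f s‖ₑ := lintegral_mono_set (Set.Ioo_subset_Ioo_right hx.2)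
    _ = eLpNorm f 1 (volume.restrict (Set.Ioo a b)) := eLpNorm_one_eq_lintegral_enorm.symm
    _ ≤ _ := by
      simpa [show (1 : ℝ) - 2⁻¹ = 2⁻¹ by norm_num] using
        eLpNorm_le_eLpNorm_mul_rpow_measure_univ (p := 1) one_le_two hF.memLp_deriv.1

lemma exists_contDiff_tendsto (hF : HasL2DerivOn F f a b) :
    ∃ w : ℕ → ℝ → ℂ, (∀ k, ContDiff ℝ ∞ (w k)) ∧
      Tendsto (fun k => eLpNorm (deriv (w k) - f) 2 (volume.restrict (Set.Ioo a b))) atTop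
        (𝓝 0) ∧
      Tendsto (fun k => eLpNorm (w k - F) 2 (volume.restrict (Set.Ioo a b))) atTop (𝓝 0) ∧
      ∀ x ∈ Set.Icc a b, Tendsto (fun k => w k x) atTop (𝓝 (F x)) := by
  set ν := volume.restrict (Set.Ioo a b)
  have hν : ν Set.univ ^ (1 / 2 : ℝ) ≠ ⊤ :=
    ENNReal.rpow_ne_top_of_nonneg (by norm_num) (measure_ne_top _ _)
  obtain ⟨g, hg, hlim⟩ := exists_contDiff_tendsto_eLpNorm_two hF.memLp_deriv
  set w : ℕ → ℝ → ℂ := fun k x => F a + ∫ s in a..x, g k s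
  have hw (k : ℕ) (x : ℝ) : HasDerivAt (w k) (g k x) x :=
    ((hg k).continuous.integral_hasStrictDerivAt a x).hasDerivAt.const_add _
  have hdw (k : ℕ) : deriv (w k) = g k := funext fun x => (hw k x).deriv
  have hsmooth (k : ℕ) : ContDiff ℝ ∞ (w k) := by
    rw [contDiff_infty_iff_deriv, hdw]
    exact ⟨fun x => (hw k x).differentiableAt, hg k⟩
  have hbound (k : ℕ) (x : ℝ) (hx : x ∈ Set.Icc a b) :
      ‖(w k - F) x‖ₑ ≤ eLpNorm (g k - f) 2 ν * ν Set.univ ^ (1 / 2 : ℝ) := by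
    refine enorm_le (hdw k ▸ (of_contDiff ((hsmooth k).of_le (by simp)) a b).sub hF) ?_ hx
    simp [w]
  have hlim' : Tendsto (fun k => eLpNorm (g k - f) 2 ν * ν Set.univ ^ (1 / 2 : ℝ)) atTop (𝓝 0) := by
    simpa using ENNReal.Tendsto.mul_const hlim (Or.inr hν)
  refine ⟨w, hsmooth, by simpa only [hdw] using hlim, ?_, fun x hx => ?_⟩
  · refine tendsto_of_tendsto_of_tendsto_of_le_of_le tendsto_const_nhds ?_ (fun _ => zero_le)
      fun k => eLpNorm_le_of_ae_enorm_bound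
        ((ae_restrict_mem measurableSet_Ioo).mono fun x hx =>
          hbound k x (Set.Ioo_subset_Icc_self hx))
    simpa using ENNReal.Tendsto.mul_const hlim' (Or.inr hν)
  · rw [tendsto_iff_edist_tendsto_0]
    refine tendsto_of_tendsto_of_tendsto_of_le_of_le tendsto_const_nhds hlim' (fun _ => zero_le)
      fun k => ?_
    rw [edist_eq_enorm_sub]
    exact hbound k x hx

lemma integral_mul_deriv (hF : HasL2DerivOn F f a b) (hab : a ≤ b) {η : ℝ → ℂ}
    (hη : ContDiff ℝ 1 η) :
    ∫ x in Set.Ioo a b, F x * deriv η x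
      = F b * η b - F a * η a - ∫ x in Set.Ioo a b, f x * η x := by
  obtain ⟨w, hw, hw', hwF, hpt⟩ := hF.exists_contDiff_tendsto
  have hη₀ : MemLp η 2 (volume.restrict (Set.Ioo a b)) := memLp_restrict_of_continuousOn
    hη.continuous.continuousOn isCompact_Icc measurableSet_Ioo Set.Ioo_subset_Icc_self
  have hη₁ := (of_contDiff hη a b).memLp_deriv
  have hsmooth (k : ℕ) := of_contDiff ((hw k).of_le (m := 1) (by simp)) a b
  have hl := tendsto_integral_mul_of_tendsto_eLpNorm_two hη₁ hF.memLp
    (fun k => (hsmooth k).memLp) hwF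
  have hr := tendsto_integral_mul_of_tendsto_eLpNorm_two hη₀ hF.memLp_deriv
    (fun k => (hsmooth k).memLp_deriv) hw'
  have hbdry := ((hpt b (Set.right_mem_Icc.2 hab)).mul_const (η b)).sub
    ((hpt a (Set.left_mem_Icc.2 hab)).mul_const (η a))
  simp only [mul_comm (F _) (deriv η _), mul_comm (f _)]
  refine tendsto_nhds_unique hl ((hbdry.sub hr).congr fun k => ?_)
  have hparts := intervalIntegral.integral_mul_deriv_eq_deriv_mul (a := a) (b := b)
    (fun x _ => ((hw k).differentiable (by simp) x).hasDerivAt)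
    (fun x _ => (hη.differentiable one_ne_zero x).hasDerivAt)
    (((hw k).continuous_deriv (by simp)).intervalIntegrable _ _)
    ((hη.continuous_deriv le_rfl).intervalIntegrable _ _)
  simp only [intervalIntegral.integral_of_le hab, integral_Ioc_eq_integral_Ioo] at hparts
  simp only [mul_comm (deriv η _), mul_comm (η _), hparts]

lemma hasWeakLineDerivOn (hF : HasL2DerivOn F f a b) : HasWeakLineDerivOn F f 1 (Set.Ioo a b) := by
  intro η hη _ hs
  rcases lt_or_ge b a with hab | hab
  · simp [Set.Ioo_eq_empty hab.le.not_gt]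
  have hzero {x : ℝ} (hx : x ∉ Set.Ioo a b) : η x = 0 :=
    image_eq_zero_of_notMem_tsupport (mt (@hs x) hx)
  have hparts := hF.integral_mul_deriv hab (hη.of_le (by simp))
  simpa [hzero (x := a) (by simp), hzero (x := b) (by simp), mul_comm] using hparts

end HasL2DerivOn

end Interval

namespace Mesh

variable {P : Grating} {T : Mesh P}

lemma strictMonoOn_node : StrictMonoOn T.node (Set.Iic T.S) :=
  strictMonoOn_Iic_of_lt_succ T.node_lt

lemma node_mono {j k : ℕ} (hjk : j ≤ k) (hk : k ≤ T.S) : T.node j ≤ T.node k :=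
  T.strictMonoOn_node.monotoneOn (hjk.trans hk) hk hjk

lemma neg_H_le_node {j : ℕ} (hj : j ≤ T.S) : -P.H ≤ T.node j :=
  T.node_zero ▸ T.node_mono (Nat.zero_le j) hj

lemma node_le_H {j : ℕ} (hj : j ≤ T.S) : T.node j ≤ P.H :=
  T.node_last ▸ T.node_mono hj le_rfl

lemma pred_S_lt : T.S - 1 < T.S := Nat.sub_one_lt T.S_pos.ne'

lemma H_mem_Icc_node : P.H ∈ Set.Icc (T.node (T.S - 1)) (T.node (T.S - 1 + 1)) := by
  rw [Nat.sub_add_cancel T.S_pos, T.node_last]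
  exact ⟨T.node_le_H T.pred_S_lt.le, le_rfl⟩

lemma neg_H_mem_Icc_node : -P.H ∈ Set.Icc (T.node 0) (T.node (0 + 1)) := by
  rw [T.node_zero]
  exact ⟨le_rfl, T.neg_H_le_node T.S_pos⟩

lemma exists_mem_Ico_node {x : ℝ} (hx : x ∈ Set.Ioo (-P.H) P.H) :
    ∃ j < T.S, x ∈ Set.Ico (T.node j) (T.node (j + 1)) := by
  have hex : ∃ k, x < T.node k := ⟨T.S, T.node_last ▸ hx.2⟩
  rcases hj : Nat.find hex with _ | j
  · exact absurd (T.node_zero ▸ hj ▸ Nat.find_spec hex) hx.1.not_gt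
  · refine ⟨j, ?_, not_lt.1 (Nat.find_min hex (hj ▸ j.lt_succ_self)), hj ▸ Nat.find_spec hex⟩
    exact hj.symm.trans_le (Nat.find_min' hex (T.node_last ▸ hx.2))

lemma ae_exists_mem_Ioo_node : ∀ᵐ x ∂(volume.restrict (Set.Ioo (-P.H) P.H)),
    ∃ j < T.S, x ∈ Set.Ioo (T.node j) (T.node (j + 1)) := by
  filter_upwards [ae_restrict_mem measurableSet_Ioo,
    ae_restrict_of_ae ((Set.countable_range T.node).ae_notMem volume)] with x hx hnode
  obtain ⟨j, hj, hxj⟩ := T.exists_mem_Ico_node hx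
  exact ⟨j, hj, lt_of_le_of_ne hxj.1 fun h => hnode ⟨j, h⟩, hxj.2⟩

lemma eq_of_mem_Ioo_node_of_mem_Icc_node {i j : ℕ} (hi : i < T.S) (hj : j < T.S) {x : ℝ}
    (hxi : x ∈ Set.Ioo (T.node i) (T.node (i + 1)))
    (hxj : x ∈ Set.Icc (T.node j) (T.node (j + 1))) : i = j := by
  rcases lt_trichotomy i j with h | h | h
  · exact absurd (hxi.2.trans_le (T.node_mono (show i + 1 ≤ j from h) hj.le)) hxj.1.not_gt
  · exact h
  · exact absurd (hxi.1.trans_le hxj.2) (T.node_mono (show j + 1 ≤ i from h) hi.le).not_gt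

lemma hasL2DerivOn {F f : ℝ → ℂ}
    (h : ∀ j < T.S, HasL2DerivOn F f (T.node j) (T.node (j + 1))) :
    HasL2DerivOn F f (-P.H) P.H := by
  suffices ∀ k < T.S, HasL2DerivOn F f (T.node 0) (T.node (k + 1)) by
    have hlast := this (T.S - 1) T.pred_S_lt
    rwa [Nat.sub_add_cancel T.S_pos, T.node_zero, T.node_last] at hlast
  intro k
  induction k with
  | zero => exact h 0
  | succ k ih =>
    intro hk
    exact (ih (Nat.lt_of_succ_lt hk)).trans (h (k + 1) hk) (T.node_mono (Nat.zero_le _) hk.le)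
      (T.node_lt (k + 1) hk).le

lemma exists_eqOn_slices {f : ℕ → ℝ → ℂ}
    (h : ∀ j, j + 1 < T.S → f j (T.node (j + 1)) = f (j + 1) (T.node (j + 1))) :
    ∃ F : ℝ → ℂ, ∀ j < T.S, Set.EqOn (f j) F (Set.Icc (T.node j) (T.node (j + 1))) := by
  have hmatch {i j : ℕ} (hij : i ≤ j) (hj : j < T.S) {x : ℝ} (hxi : x ≤ T.node (i + 1))
      (hxj : T.node j ≤ x) : f i x = f j x := by
    rcases hij.eq_or_lt with rfl | hij
    · rfl
    have hnode : T.node j = T.node (i + 1) :=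
      le_antisymm (hxj.trans hxi) (T.node_mono hij hj.le)
    obtain rfl : j = i + 1 :=
      T.strictMonoOn_node.injOn hj.le ((Nat.succ_le_of_lt hij).trans hj.le) hnode
    obtain rfl : x = T.node (i + 1) := le_antisymm hxi hxj
    exact h i hj
  classical
  refine ⟨fun x => if hx : ∃ j < T.S, x ∈ Set.Icc (T.node j) (T.node (j + 1)) then
    f hx.choose x else 0, fun j hj x hx => ?_⟩
  have hex : ∃ j < T.S, x ∈ Set.Icc (T.node j) (T.node (j + 1)) := ⟨j, hj, hx⟩
  obtain ⟨hi, hxi⟩ := hex.choose_spec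
  simp only [dif_pos hex]
  rcases le_total j hex.choose with hij | hij
  · exact hmatch hij hi hx.2 hxi.1
  · exact (hmatch hij hj hxi.2 hx.1).symm

end Mesh

section Modes

variable (P : Grating)

/-- Lebesgue measure on `(-H,H)`. -/
abbrev volI : Measure ℝ := volume.restrict (Set.Ioo (-P.H) P.H)

lemma volΩ_eq_prod : volΩ P = (volΓ P).prod (volI P) := (Measure.prod_restrict _ _).symm

instance : IsFiniteMeasure (volΓ P) := by unfold volΓ; infer_instance

instance : IsFiniteMeasure (volΩ P) := by rw [volΩ_eq_prod]; infer_instance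

lemma norm_mode (n : ℤ) (x : ℝ) : ‖mode P n x‖ = 1 := by
  rw [mode, show I * (α P n : ℂ) * x = ((α P n * x : ℝ) : ℂ) * I by push_cast; ring]
  exact norm_exp_ofReal_mul_I _

lemma hasDerivAt_mode (n : ℤ) (x : ℝ) :
    HasDerivAt (mode P n) (I * α P n * mode P n x) x := by
  have h : HasDerivAt (fun y : ℝ => I * (α P n : ℂ) * y) (I * α P n) x := by
    simpa using (hasDerivAt_id x).ofReal_comp.const_mul (I * (α P n : ℂ))
  rw [mul_comm]
  exact h.cexp

lemma contDiff_mode (n : ℤ) : ContDiff ℝ ∞ (mode P n) :=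
  (contDiff_const.mul ofRealCLM.contDiff).cexp

lemma continuous_mode (n : ℤ) : Continuous (mode P n) := (contDiff_mode P n).continuous

lemma memLp_mode (n : ℤ) : MemLp (mode P n) 2 (volΓ P) :=
  MemLp.of_bound (continuous_mode P n).aestronglyMeasurable 1
    (Eventually.of_forall fun x => (norm_mode P n x).le)

lemma conj_mode (n : ℤ) (x : ℝ) : conj (mode P n x) = exp (-(I * α P n * x)) := by
  simp [mode, ← exp_conj]

lemma mode_mul_conj_mode (m n : ℤ) (x : ℝ) : mode P m x * conj (mode P n x)
    = exp (-(I * ((n - m : ℤ) * (2 * Real.pi / P.L) : ℝ) * x)) := by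
  rw [conj_mode, mode, ← exp_add]
  congr 1
  simp only [α]
  push_cast
  ring

lemma mode_add_period (n : ℤ) (x : ℝ) :
    mode P n (x + P.L) = exp (I * α P 0 * P.L) * mode P n x := by
  have hL : (P.L : ℂ) ≠ 0 := by exact_mod_cast P.L_pos.ne'
  have h : I * α P n * ((x + P.L : ℝ) : ℂ)
      = I * α P 0 * P.L + I * α P n * x + n * (2 * Real.pi * I) := by
    simp only [α]; push_cast; field_simp; ring
  rw [mode, h, exp_add, exp_int_mul_two_pi_mul_I, mul_one, exp_add, mode]

end Modes

section Fields

variable {P : Grating} {M : ℕ}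

lemma eLpNorm_comp_snd_mul_mode {f : ℝ → ℂ} (hf : AEStronglyMeasurable f (volI P)) (n : ℤ) :
    eLpNorm (fun x : ℝ × ℝ => f x.2 * mode P n x.1) 2 (volΩ P)
      = volΓ P Set.univ ^ (1 / 2 : ℝ) * eLpNorm f 2 (volI P) := by
  have hmap : (volΩ P).map Prod.snd = volΓ P Set.univ • volI P := by
    rw [volΩ_eq_prod, Measure.map_snd_prod]
  calc eLpNorm (fun x : ℝ × ℝ => f x.2 * mode P n x.1) 2 (volΩ P)
      = eLpNorm (f ∘ Prod.snd) 2 (volΩ P) :=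
        eLpNorm_congr_norm_ae (Eventually.of_forall fun x => by simp [norm_mode])
    _ = eLpNorm f 2 (volΓ P Set.univ • volI P) := by
        rw [← hmap, eLpNorm_map_measure (hmap ▸ hf.smul_measure _) measurable_snd.aemeasurable]
    _ = volΓ P Set.univ ^ (1 / 2 : ℝ) * eLpNorm f 2 (volI P) := by
        simp [eLpNorm_smul_measure_of_ne_top]

lemma memLp_comp_snd_mul_mode {f : ℝ → ℂ} (hf : MemLp f 2 (volI P)) (n : ℤ) :
    MemLp (fun x : ℝ × ℝ => f x.2 * mode P n x.1) 2 (volΩ P) := by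
  refine ⟨?_, ?_⟩
  · rw [volΩ_eq_prod]
    exact hf.1.comp_snd.mul ((continuous_mode P n).comp continuous_fst).aestronglyMeasurable
  · rw [eLpNorm_comp_snd_mul_mode hf.1]
    exact ENNReal.mul_lt_top (ENNReal.rpow_lt_top_of_nonneg (by simp) (measure_ne_top _ _)) hf.2

lemma field_eq_sum (u : ℤ → ℝ → ℂ) : field P M u =
    ∑ n ∈ Finset.Icc (-(M : ℤ)) M, fun x : ℝ × ℝ => u n x.2 * mode P n x.1 := by
  ext x
  simp [field]

lemma memLp_field {g : ℤ → ℝ → ℂ} (hg : ∀ n ∈ Finset.Icc (-(M : ℤ)) M, MemLp (g n) 2 (volI P)) :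
    MemLp (field P M g) 2 (volΩ P) :=
  memLp_finsetSum _ fun n hn => memLp_comp_snd_mul_mode (hg n hn) n

lemma memLp_field_trace (g : ℤ → ℝ → ℂ) (y : ℝ) :
    MemLp (fun x₁ => field P M g (x₁, y)) 2 (volΓ P) :=
  memLp_finsetSum _ fun n _ => (memLp_mode P n).const_mul (g n y)

lemma pd₁_field (g : ℤ → ℝ → ℂ) :
    pd₁ (field P M g) = field P M (fun n x₂ => I * α P n * g n x₂) :=
  funext fun x => HasDerivAt.deriv <| HasDerivAt.fun_sum fun n _ =>
    ((hasDerivAt_mode P n x.1).const_mul (g n x.2)).congr_deriv (by ring)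

lemma pd₂_field {g : ℤ → ℝ → ℂ} (hg : ∀ n ∈ Finset.Icc (-(M : ℤ)) M, Differentiable ℝ (g n)) :
    pd₂ (field P M g) = field P M (fun n => deriv (g n)) :=
  funext fun x => HasDerivAt.deriv <| HasDerivAt.fun_sum fun n hn =>
    (hg n hn x.2).hasDerivAt.mul_const (mode P n x.1)

lemma isSmoothQP_field {g : ℤ → ℝ → ℂ} (hg : ∀ n ∈ Finset.Icc (-(M : ℤ)) M, ContDiff ℝ ∞ (g n)) :
    IsSmoothQP P (field P M g) := by
  refine ⟨ContDiff.sum fun n hn => ((hg n hn).comp contDiff_snd).mul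
    ((contDiff_mode P n).comp contDiff_fst), fun x₁ x₂ => ?_⟩
  simp only [field, mode_add_period, Finset.mul_sum]
  exact Finset.sum_congr rfl fun n _ => by ring

lemma tendsto_eLpNorm_sum_sub_sum {ι X E : Type*} [MeasurableSpace X] [NormedAddCommGroup E]
    {μ : Measure X} {p : ENNReal} (hp : 1 ≤ p) {s : Finset ι} {φ : ι → ℕ → X → E} {f : ι → X → E}
    (hφ : ∀ i ∈ s, ∀ k, AEStronglyMeasurable (φ i k) μ)
    (hf : ∀ i ∈ s, AEStronglyMeasurable (f i) μ)
    (h : ∀ i ∈ s, Tendsto (fun k => eLpNorm (φ i k - f i) p μ) atTop (𝓝 0)) :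
    Tendsto (fun k => eLpNorm (∑ i ∈ s, φ i k - ∑ i ∈ s, f i) p μ) atTop (𝓝 0) := by
  refine tendsto_of_tendsto_of_tendsto_of_le_of_le tendsto_const_nhds
    (by simpa using tendsto_finsetSum s h) (fun _ => zero_le) fun k => ?_
  rw [← Finset.sum_sub_distrib]
  exact eLpNorm_sum_le (fun i hi => (hφ i hi k).sub (hf i hi)) hp

lemma tendsto_eLpNorm_field_sub {w : ℤ → ℕ → ℝ → ℂ} {g : ℤ → ℝ → ℂ}
    (hw : ∀ n ∈ Finset.Icc (-(M : ℤ)) M, ∀ k, MemLp (w n k) 2 (volI P))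
    (hg : ∀ n ∈ Finset.Icc (-(M : ℤ)) M, MemLp (g n) 2 (volI P))
    (h : ∀ n ∈ Finset.Icc (-(M : ℤ)) M,
      Tendsto (fun k => eLpNorm (w n k - g n) 2 (volI P)) atTop (𝓝 0)) :
    Tendsto (fun k => eLpNorm (field P M (fun n => w n k) - field P M g) 2 (volΩ P)) atTop
      (𝓝 0) := by
  simp only [field_eq_sum]
  refine tendsto_eLpNorm_sum_sub_sum one_le_two
    (fun n hn k => (memLp_comp_snd_mul_mode (hw n hn k) n).1)
    (fun n hn => (memLp_comp_snd_mul_mode (hg n hn) n).1) fun n hn => ?_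
  have hconst : volΓ P Set.univ ^ (1 / 2 : ℝ) ≠ ⊤ :=
    ENNReal.rpow_ne_top_of_nonneg (by simp) (measure_ne_top _ _)
  have hlim := ENNReal.Tendsto.const_mul (h n hn) (Or.inr hconst)
  rw [mul_zero] at hlim
  refine hlim.congr fun k => ?_
  rw [← eLpNorm_comp_snd_mul_mode ((hw n hn k).sub (hg n hn)).1 n]
  exact congrArg (eLpNorm · 2 (volΩ P)) (funext fun x => sub_mul _ _ _)

lemma tendsto_eLpNorm_field_trace_sub {w : ℤ → ℕ → ℝ → ℂ} {g : ℤ → ℝ → ℂ} {y : ℝ}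
    (h : ∀ n ∈ Finset.Icc (-(M : ℤ)) M, Tendsto (fun k => w n k y) atTop (𝓝 (g n y))) :
    Tendsto (fun k => eLpNorm ((fun x₁ => field P M (fun n => w n k) (x₁, y))
      - fun x₁ => field P M g (x₁, y)) 2 (volΓ P)) atTop (𝓝 0) := by
  have hsum (u : ℤ → ℝ → ℂ) : (fun x₁ => field P M u (x₁, y))
      = ∑ n ∈ Finset.Icc (-(M : ℤ)) M, fun x₁ => u n y * mode P n x₁ := by
    ext x₁
    simp [field]
  simp only [hsum]
  refine tendsto_eLpNorm_sum_sub_sum one_le_two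
    (fun n _ k => ((memLp_mode P n).const_mul (w n k y)).1)
    (fun n _ => ((memLp_mode P n).const_mul (g n y)).1) fun n hn => ?_
  have hlim := ENNReal.Tendsto.mul_const (tendsto_iff_edist_tendsto_0.1 (h n hn))
    (Or.inr (memLp_mode P n).2.ne)
  rw [zero_mul] at hlim
  refine hlim.congr fun k => ?_
  rw [edist_eq_enorm_sub, ← eLpNorm_const_smul]
  exact congrArg (eLpNorm · 2 (volΓ P)) (funext fun x => sub_mul _ _ _)

/-- The finite modal expansion with coefficients `u_n` in `H¹(-H,H)`, with derivatives `u_n'`, as an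
element of `H¹_qp(Ω)`. -/
def H1qp.ofField (M : ℕ) (u u' : ℤ → ℝ → ℂ)
    (hu : ∀ n ∈ Finset.Icc (-(M : ℤ)) M, HasL2DerivOn (u n) (u' n) (-P.H) P.H) : H1qp P where
  val := field P M u
  d₁ := field P M (fun n x₂ => I * α P n * u n x₂)
  d₂ := field P M u'
  top x₁ := field P M u (x₁, P.H)
  bot x₁ := field P M u (x₁, -P.H)
  memLp_val := memLp_field fun n hn => (hu n hn).memLp
  memLp_d₁ := memLp_field fun n hn => (hu n hn).memLp.const_mul _
  memLp_d₂ := memLp_field fun n hn => (hu n hn).memLp_deriv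
  memLp_top := memLp_field_trace u P.H
  memLp_bot := memLp_field_trace u (-P.H)
  approx := by
    have hH : -P.H ≤ P.H := neg_le_self P.H_pos.le
    choose! w hw hw' hwu hpt using fun n hn => (hu n hn).exists_contDiff_tendsto
    have hC1 (n : ℤ) (hn : n ∈ Finset.Icc (-(M : ℤ)) M) (k : ℕ) :=
      HasL2DerivOn.of_contDiff ((hw n hn k).of_le (m := 1) (by simp)) (-P.H) P.H
    refine ⟨fun k => field P M fun n => w n k,
      fun k => isSmoothQP_field fun n hn => hw n hn k,
      tendsto_eLpNorm_field_sub (fun n hn k => (hC1 n hn k).memLp) (fun n hn => (hu n hn).memLp)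
        hwu, ?_, ?_,
      tendsto_eLpNorm_field_trace_sub fun n hn => hpt n hn _ (Set.right_mem_Icc.2 hH),
      tendsto_eLpNorm_field_trace_sub fun n hn => hpt n hn _ (Set.left_mem_Icc.2 hH)⟩
    · simp only [pd₁_field]
      refine tendsto_eLpNorm_field_sub (w := fun n k x₂ => I * α P n * w n k x₂)
        (fun n hn k => (hC1 n hn k).memLp.const_mul _) (fun n hn => (hu n hn).memLp.const_mul _)
        fun n hn => ?_
      have hlim := ENNReal.Tendsto.const_mul (a := ‖I * (α P n : ℂ)‖ₑ) (hwu n hn)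
        (Or.inr enorm_ne_top)
      rw [mul_zero] at hlim
      refine hlim.congr fun k => ?_
      rw [← eLpNorm_const_smul]
      exact congrArg (eLpNorm · 2 (volI P)) (funext fun x => mul_sub _ _ _)
    · have hpd₂ (k : ℕ) : pd₂ (field P M fun n => w n k) = field P M fun n => deriv (w n k) :=
        pd₂_field fun n hn => (hw n hn k).differentiable (by simp)
      simp only [hpd₂]
      exact tendsto_eLpNorm_field_sub (fun n hn k => (hC1 n hn k).memLp_deriv)
        (fun n hn => (hu n hn).memLp_deriv) hw'

end Fields

section Galerkin

variable {P : Grating} {M : ℕ}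

lemma memH1Interval_iff {ξ : ℝ → ℂ} : MemH1Interval P ξ ↔ MemLp ξ 2 (volI P) ∧
    ∃ ξ', MemLp ξ' 2 (volI P) ∧ HasWeakLineDerivOn ξ ξ' 1 (Set.Ioo (-P.H) P.H) := by
  simp only [MemH1Interval, HasWeakLineDerivOn, fderiv_apply_one_eq_deriv, mul_comm]

lemma HasL2DerivOn.memH1Interval {ξ ξ' : ℝ → ℂ} (h : HasL2DerivOn ξ ξ' (-P.H) P.H) :
    MemH1Interval P ξ :=
  memH1Interval_iff.2 ⟨h.memLp, ξ', h.memLp_deriv, h.hasWeakLineDerivOn⟩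

lemma MemH1Interval.const_mul {ξ : ℝ → ℂ} (h : MemH1Interval P ξ) (c : ℂ) :
    MemH1Interval P (fun x => c * ξ x) := by
  obtain ⟨hξ, ξ', hξ', hd⟩ := memH1Interval_iff.1 h
  exact memH1Interval_iff.2 ⟨hξ.const_mul c, _, hξ'.const_mul c, hd.const_mul c⟩

lemma MemH1Interval.add {ξ ζ : ℝ → ℂ} (h : MemH1Interval P ξ) (h' : MemH1Interval P ζ) :
    MemH1Interval P (fun x => ξ x + ζ x) := by
  obtain ⟨hξ, ξ', hξ', hd⟩ := memH1Interval_iff.1 h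
  obtain ⟨hζ, ζ', hζ', hd'⟩ := memH1Interval_iff.1 h'
  exact memH1Interval_iff.2 ⟨hξ.add hζ, _, hξ'.add hζ', hd.add hd' (hξ.integrable one_le_two)
    (hζ.integrable one_le_two) (hξ'.integrable one_le_two) (hζ'.integrable one_le_two)⟩

lemma MemH1Interval.zero : MemH1Interval P (fun _ => 0) :=
  (HasL2DerivOn.of_contDiff contDiff_const _ _).memH1Interval

lemma exists_coeff_of_mem_E {e : ℝ → ℂ} (he : e ∈ E P M) :
    ∃ c : ℤ → ℂ, e = ∑ n ∈ Finset.Icc (-(M : ℤ)) M, c n • mode P n := by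
  rw [E, ← Finset.coe_Icc, Submodule.mem_span_image_finset_iff_exists_fun'] at he
  obtain ⟨c, rfl⟩ := he
  exact ⟨c, rfl⟩

lemma mem_V_iff {v : H1qp P} : v ∈ V P M ↔
    ∃ ξ : ℤ → ℝ → ℂ, (∀ n ∈ Finset.Icc (-(M : ℤ)) M, MemH1Interval P (ξ n)) ∧
      v.val =ᵐ[volΩ P] field P M ξ := by
  constructor
  · rintro ⟨g, hg, hvg⟩
    suffices ∃ ξ : ℤ → ℝ → ℂ, (∀ n ∈ Finset.Icc (-(M : ℤ)) M, MemH1Interval P (ξ n)) ∧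
        g = field P M ξ by
      obtain ⟨ξ, hξ, rfl⟩ := this
      exact ⟨ξ, hξ, hvg⟩
    clear hvg
    induction hg using Submodule.span_induction with
    | mem g hg =>
      obtain ⟨ξ, e, hξ, he, rfl⟩ := hg
      obtain ⟨c, rfl⟩ := exists_coeff_of_mem_E he
      refine ⟨fun n x₂ => c n * ξ x₂, fun n _ => hξ.const_mul (c n), funext fun x => ?_⟩
      simp [field, Finset.mul_sum, mul_assoc, mul_left_comm (ξ _)]
    | zero => exact ⟨fun _ _ => 0, fun _ _ => .zero, by ext; simp [field]⟩
    | add g₁ g₂ _ _ h₁ h₂ =>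
      obtain ⟨ξ₁, h₁, rfl⟩ := h₁
      obtain ⟨ξ₂, h₂, rfl⟩ := h₂
      exact ⟨fun n x₂ => ξ₁ n x₂ + ξ₂ n x₂, fun n hn => (h₁ n hn).add (h₂ n hn),
        by ext; simp [field, add_mul, Finset.sum_add_distrib]⟩
    | smul c g _ h =>
      obtain ⟨ξ, h, rfl⟩ := h
      exact ⟨fun n x₂ => c * ξ n x₂, fun n hn => (h n hn).const_mul c,
        by ext; simp [field, Finset.mul_sum, mul_assoc]⟩
  · rintro ⟨ξ, hξ, hv⟩
    refine ⟨field P M ξ, ?_, hv⟩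
    rw [field_eq_sum]
    exact Submodule.sum_mem _ fun n hn => Submodule.subset_span
      ⟨ξ n, mode P n, hξ n hn, Submodule.subset_span ⟨n, Finset.mem_Icc.1 hn, rfl⟩, rfl⟩

lemma pd₁_eq_fderiv {φ : ℝ × ℝ → ℂ} (hφ : Differentiable ℝ φ) :
    pd₁ φ = fun x => fderiv ℝ φ x (1, 0) :=
  funext fun x => ((hφ x).hasFDerivAt.comp_hasDerivAt x.1
    ((hasDerivAt_id x.1).prodMk (hasDerivAt_const x.1 x.2))).deriv

lemma pd₂_eq_fderiv {φ : ℝ × ℝ → ℂ} (hφ : Differentiable ℝ φ) :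
    pd₂ φ = fun x => fderiv ℝ φ x (0, 1) :=
  funext fun x => ((hφ x).hasFDerivAt.comp_hasDerivAt x.2
    ((hasDerivAt_const x.2 x.1).prodMk (hasDerivAt_id x.2))).deriv

lemma memLp_volΩ_of_continuous {φ : ℝ × ℝ → ℂ} (hφ : Continuous φ) : MemLp φ 2 (volΩ P) :=
  memLp_restrict_of_continuousOn hφ.continuousOn (isCompact_Icc.prod isCompact_Icc)
    (measurableSet_Ioo.prod measurableSet_Ioo)
    (Set.prod_mono Set.Ioo_subset_Icc_self Set.Ioo_subset_Icc_self)

lemma memLp_pd₁ {φ : ℝ × ℝ → ℂ} (hφ : ContDiff ℝ 1 φ) : MemLp (pd₁ φ) 2 (volΩ P) :=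
  pd₁_eq_fderiv (hφ.differentiable one_ne_zero) ▸
    memLp_volΩ_of_continuous (continuous_fderiv_apply hφ _)

lemma memLp_pd₂ {φ : ℝ × ℝ → ℂ} (hφ : ContDiff ℝ 1 φ) : MemLp (pd₂ φ) 2 (volΩ P) :=
  pd₂_eq_fderiv (hφ.differentiable one_ne_zero) ▸
    memLp_volΩ_of_continuous (continuous_fderiv_apply hφ _)

namespace H1qp

variable (v : H1qp P)

lemma hasWeakLineDerivOn_d₁ : HasWeakLineDerivOn v.val v.d₁ (1, 0) (Omega P) := by
  obtain ⟨φ, hφ, hval, hd₁, -⟩ := v.approx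
  have hC1 (k : ℕ) : ContDiff ℝ 1 (φ k) := (hφ k).1.of_le (by simp)
  have hweak (k : ℕ) : HasWeakLineDerivOn (φ k) (pd₁ (φ k)) (1, 0) (Omega P) :=
    pd₁_eq_fderiv ((hC1 k).differentiable one_ne_zero) ▸ .of_contDiff (hC1 k) _ _
  exact .of_tendsto hweak v.memLp_val (fun k => memLp_volΩ_of_continuous (hC1 k).continuous) hval
    v.memLp_d₁ (fun k => memLp_pd₁ (hC1 k)) hd₁

lemma hasWeakLineDerivOn_d₂ : HasWeakLineDerivOn v.val v.d₂ (0, 1) (Omega P) := by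
  obtain ⟨φ, hφ, hval, -, hd₂, -⟩ := v.approx
  have hC1 (k : ℕ) : ContDiff ℝ 1 (φ k) := (hφ k).1.of_le (by simp)
  have hweak (k : ℕ) : HasWeakLineDerivOn (φ k) (pd₂ (φ k)) (0, 1) (Omega P) :=
    pd₂_eq_fderiv ((hC1 k).differentiable one_ne_zero) ▸ .of_contDiff (hC1 k) _ _
  exact .of_tendsto hweak v.memLp_val (fun k => memLp_volΩ_of_continuous (hC1 k).continuous) hval
    v.memLp_d₂ (fun k => memLp_pd₂ (hC1 k)) hd₂

end H1qp

lemma isOpen_Omega : IsOpen (Omega P) := isOpen_Ioo.prod isOpen_Ioo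

lemma hasWeakLineDerivOn_mode (n : ℤ) :
    HasWeakLineDerivOn (mode P n) (fun x => I * α P n * mode P n x) 1 (Set.Ioo 0 P.L) := by
  have h := HasWeakLineDerivOn.of_contDiff ((contDiff_mode P n).of_le (m := 1) (by simp)) 1
    (Set.Ioo 0 P.L)
  simpa only [fderiv_apply_one_eq_deriv, (hasDerivAt_mode P n _).deriv] using h

variable {ξ ξ' : ℤ → ℝ → ℂ} {v : H1qp P}

lemma hasWeakLineDerivOn_field_fst (hξ : ∀ n ∈ Finset.Icc (-(M : ℤ)) M, MemLp (ξ n) 2 (volI P)) :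
    HasWeakLineDerivOn (field P M ξ) (field P M fun n x₂ => I * α P n * ξ n x₂) (1, 0)
      (Omega P) := by
  refine .sum (fun n hn => ?_)
    (fun n hn => (memLp_comp_snd_mul_mode (hξ n hn) n).integrable one_le_two)
    (fun n hn => (memLp_comp_snd_mul_mode ((hξ n hn).const_mul _) n).integrable one_le_two)
  simpa only [Omega, mul_left_comm, mul_assoc] using (hasWeakLineDerivOn_mode n).mul_comp_fst
    ((memLp_mode P n).integrable one_le_two)
    (((memLp_mode P n).const_mul (I * α P n)).integrable one_le_two)
    ((hξ n hn).integrable one_le_two)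

lemma hasWeakLineDerivOn_field_snd (hξ : ∀ n ∈ Finset.Icc (-(M : ℤ)) M, MemLp (ξ n) 2 (volI P))
    (hξ' : ∀ n ∈ Finset.Icc (-(M : ℤ)) M, MemLp (ξ' n) 2 (volI P))
    (h : ∀ n ∈ Finset.Icc (-(M : ℤ)) M,
      HasWeakLineDerivOn (ξ n) (ξ' n) 1 (Set.Ioo (-P.H) P.H)) :
    HasWeakLineDerivOn (field P M ξ) (field P M ξ') (0, 1) (Omega P) :=
  .sum (fun n hn => (h n hn).comp_snd_mul ((hξ n hn).integrable one_le_two)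
      ((hξ' n hn).integrable one_le_two) ((memLp_mode P n).integrable one_le_two))
    (fun n hn => (memLp_comp_snd_mul_mode (hξ n hn) n).integrable one_le_two)
    (fun n hn => (memLp_comp_snd_mul_mode (hξ' n hn) n).integrable one_le_two)

lemma exists_gradient_ae_eq_field_of_mem_V (hv : v ∈ V P M) :
    ∃ ξ ξ' : ℤ → ℝ → ℂ, (∀ n ∈ Finset.Icc (-(M : ℤ)) M, MemLp (ξ n) 2 (volI P)) ∧
      (∀ n ∈ Finset.Icc (-(M : ℤ)) M, MemLp (ξ' n) 2 (volI P)) ∧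
      v.val =ᵐ[volΩ P] field P M ξ ∧
      v.d₁ =ᵐ[volΩ P] field P M (fun n x₂ => I * α P n * ξ n x₂) ∧
      v.d₂ =ᵐ[volΩ P] field P M ξ' := by
  obtain ⟨ξ, hξ, hvξ⟩ := mem_V_iff.1 hv
  choose! hξL2 ξ' hξ'L2 hξξ' using fun n hn => memH1Interval_iff.1 (hξ n hn)
  refine ⟨ξ, ξ', hξL2, hξ'L2, hvξ, ?_, ?_⟩
  · exact (v.hasWeakLineDerivOn_d₁.congr_left hvξ).ae_eq (hasWeakLineDerivOn_field_fst hξL2)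
      isOpen_Omega (v.memLp_d₁.integrable one_le_two)
      ((memLp_field fun n hn => (hξL2 n hn).const_mul _).integrable one_le_two)
  · exact (v.hasWeakLineDerivOn_d₂.congr_left hvξ).ae_eq
      (hasWeakLineDerivOn_field_snd hξL2 hξ'L2 hξξ') isOpen_Omega
      (v.memLp_d₂.integrable one_le_two) ((memLp_field hξ'L2).integrable one_le_two)

end Galerkin

section Coefficients

variable (P : Grating)

lemma L_ne_zero : (P.L : ℂ) ≠ 0 := ofReal_ne_zero.2 P.L_pos.ne'

lemma L_mul_qpCoeff (n : ℤ) (φ : ℝ → ℂ) :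
    P.L * qpCoeff P n φ = ∫ x, φ x * conj (mode P n x) ∂(volΓ P) := by
  simp only [qpCoeff, conj_mode, volΓ]
  rw [← mul_assoc, mul_one_div_cancel (L_ne_zero P), one_mul]

variable {P} {M : ℕ}

lemma L_mul_conj_qpCoeff (n : ℤ) (φ : ℝ → ℂ) :
    P.L * conj (qpCoeff P n φ) = ∫ x, mode P n x * conj (φ x) ∂(volΓ P) := by
  have h := congrArg conj (L_mul_qpCoeff P n φ)
  rw [map_mul, conj_ofReal, ← integral_conj] at h
  simpa only [map_mul, conj_conj, mul_comm (conj (φ _))] using h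

lemma qpCoeff_const_mul (n : ℤ) (c : ℂ) (φ : ℝ → ℂ) :
    qpCoeff P n (fun x => c * φ x) = c * qpCoeff P n φ := by
  simp only [qpCoeff, mul_assoc, integral_const_mul]
  ring

lemma qpCoeff_sub {φ ψ : ℝ → ℂ} (n : ℤ) (hφ : MemLp φ 2 (volΓ P)) (hψ : MemLp ψ 2 (volΓ P)) :
    qpCoeff P n (fun x => φ x - ψ x) = qpCoeff P n φ - qpCoeff P n ψ := by
  refine mul_left_cancel₀ (L_ne_zero P) ?_
  simp only [mul_sub, L_mul_qpCoeff, sub_mul]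
  exact integral_sub (integrable_mul_conj_of_memLp_two hφ (memLp_mode P n))
    (integrable_mul_conj_of_memLp_two hψ (memLp_mode P n))

lemma qpCoeff_sum {s : Finset ℤ} (n : ℤ) {φ : ℤ → ℝ → ℂ}
    (hφ : ∀ m ∈ s, MemLp (φ m) 2 (volΓ P)) :
    qpCoeff P n (fun x => ∑ m ∈ s, φ m x) = ∑ m ∈ s, qpCoeff P n (φ m) := by
  refine mul_left_cancel₀ (L_ne_zero P) ?_
  simp only [Finset.mul_sum, L_mul_qpCoeff, Finset.sum_mul]
  exact integral_finsetSum _ fun m hm => integrable_mul_conj_of_memLp_two (hφ m hm) (memLp_mode P n)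

lemma qpCoeff_mode_self (n : ℤ) : qpCoeff P n (mode P n) = 1 := by
  refine mul_left_cancel₀ (L_ne_zero P) ?_
  simp [L_mul_qpCoeff, mul_conj, normSq_eq_norm_sq, norm_mode, volΓ, measureReal_def, P.L_pos.le]

lemma qpCoeff_mode_of_ne {m n : ℤ} (h : m ≠ n) : qpCoeff P n (mode P m) = 0 := by
  let k : ℂ := -(I * ((n - m : ℤ) * (2 * Real.pi / P.L) : ℝ))
  have hk : k ≠ 0 := by
    simp [k, sub_eq_zero, h.symm, P.L_pos.ne', Real.pi_ne_zero]
  have hkL : k * P.L = ((m - n : ℤ) : ℂ) * (2 * Real.pi * I) := by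
    have := L_ne_zero P
    simp only [k]
    push_cast
    field_simp
    ring
  have hexp (x : ℝ) : mode P m x * conj (mode P n x) = exp (k * x) := by
    rw [mode_mul_conj_mode, ← neg_mul]
  refine mul_left_cancel₀ (L_ne_zero P) ?_
  simp only [L_mul_qpCoeff, hexp, volΓ]
  rw [← integral_Ioc_eq_integral_Ioo, ← intervalIntegral.integral_of_le P.L_pos.le,
    integral_exp_mul_complex hk, hkL, exp_int_mul_two_pi_mul_I]
  simp

lemma qpCoeff_field (g : ℤ → ℝ → ℂ) {n : ℤ} (hn : n ∈ Finset.Icc (-(M : ℤ)) M) (y : ℝ) :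
    qpCoeff P n (fun x => field P M g (x, y)) = g n y := by
  simp only [field]
  rw [qpCoeff_sum n fun m _ => (memLp_mode P m).const_mul (g m y), Finset.sum_eq_single_of_mem n hn]
  · rw [qpCoeff_const_mul, qpCoeff_mode_self, mul_one]
  · intro m _ hmn
    rw [qpCoeff_const_mul, qpCoeff_mode_of_ne hmn, mul_zero]

lemma qpCoeff_field_of_notMem (g : ℤ → ℝ → ℂ) {n : ℤ} (hn : n ∉ Finset.Icc (-(M : ℤ)) M) (y : ℝ) :
    qpCoeff P n (fun x => field P M g (x, y)) = 0 := by
  simp only [field]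
  rw [qpCoeff_sum n fun m _ => (memLp_mode P m).const_mul (g m y)]
  refine Finset.sum_eq_zero fun m hm => ?_
  rw [qpCoeff_const_mul, qpCoeff_mode_of_ne (ne_of_mem_of_not_mem hm hn), mul_zero]

variable {K : ℝ × ℝ → ℂ}

lemma integral_mul_conj_comp_snd_mul_mode (y : ℝ) (c : ℂ) (n : ℤ) :
    ∫ x, K (x, y) * conj (c * mode P n x) ∂(volΓ P)
      = P.L * (qpCoeff P n (fun x => K (x, y)) * conj c) := by
  simp only [← mul_assoc, L_mul_qpCoeff, ← integral_mul_const, map_mul, mul_right_comm]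

lemma integrable_qpCoeff_mul_conj (hK : MemLp K 2 (volΩ P)) {g : ℝ → ℂ}
    (hg : MemLp g 2 (volI P)) (n : ℤ) :
    Integrable (fun y => qpCoeff P n (fun x => K (x, y)) * conj (g y)) (volI P) := by
  have hint := integrable_mul_conj_of_memLp_two hK (memLp_comp_snd_mul_mode hg n)
  rw [volΩ_eq_prod] at hint
  have hcoeff := hint.integral_prod_right
  simp only [integral_mul_conj_comp_snd_mul_mode] at hcoeff
  exact (integrable_const_mul_iff (L_ne_zero P).isUnit _).1 hcoeff

lemma integral_mul_conj_field (hK : MemLp K 2 (volΩ P)) {g : ℤ → ℝ → ℂ}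
    (hg : ∀ n ∈ Finset.Icc (-(M : ℤ)) M, MemLp (g n) 2 (volI P)) :
    ∫ x, K x * conj (field P M g x) ∂(volΩ P) = P.L * ∑ n ∈ Finset.Icc (-(M : ℤ)) M,
      ∫ y, qpCoeff P n (fun x => K (x, y)) * conj (g n y) ∂(volI P) := by
  simp only [field, map_sum, Finset.mul_sum]
  rw [integral_finsetSum _ fun n hn =>
    integrable_mul_conj_of_memLp_two hK (memLp_comp_snd_mul_mode (hg n hn) n)]
  refine Finset.sum_congr rfl fun n hn => ?_
  have hint := integrable_mul_conj_of_memLp_two hK (memLp_comp_snd_mul_mode (hg n hn) n)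
  rw [volΩ_eq_prod] at hint ⊢
  rw [integral_prod_symm _ hint, ← integral_const_mul]
  simp only [integral_mul_conj_comp_snd_mul_mode]

lemma memLp_volΓ_of_continuous {φ : ℝ → ℂ} (hφ : Continuous φ) : MemLp φ 2 (volΓ P) :=
  memLp_restrict_of_continuousOn hφ.continuousOn isCompact_Icc measurableSet_Ioo
    Set.Ioo_subset_Icc_self

variable {F f : ℝ → ℂ}

lemma integral_mul_conj_pd₂_of_contDiff (hF : HasL2DerivOn F f (-P.H) P.H) (n : ℤ)
    {φ : ℝ × ℝ → ℂ} (hφ : ContDiff ℝ 1 φ) :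
    ∫ x, F x.2 * mode P n x.1 * conj (pd₂ φ x) ∂(volΩ P)
      = F P.H * ∫ x, mode P n x * conj (φ (x, P.H)) ∂(volΓ P)
        - F (-P.H) * ∫ x, mode P n x * conj (φ (x, -P.H)) ∂(volΓ P)
        - ∫ x, f x.2 * mode P n x.1 * conj (φ x) ∂(volΩ P) := by
  have hintF := integrable_mul_conj_of_memLp_two (memLp_comp_snd_mul_mode hF.memLp n) (memLp_pd₂ hφ)
  have hintf := integrable_mul_conj_of_memLp_two (memLp_comp_snd_mul_mode hF.memLp_deriv n)
    (memLp_volΩ_of_continuous hφ.continuous)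
  have htrace (y : ℝ) : Integrable (fun x => mode P n x * conj (φ (x, y))) (volΓ P) :=
    integrable_mul_conj_of_memLp_two (memLp_mode P n)
      (memLp_volΓ_of_continuous (hφ.continuous.comp (by fun_prop)))
  have hline (x : ℝ) : ∫ y, F y * mode P n x * conj (pd₂ φ (x, y)) ∂(volI P)
      = F P.H * (mode P n x * conj (φ (x, P.H))) - F (-P.H) * (mode P n x * conj (φ (x, -P.H)))
        - ∫ y, f y * mode P n x * conj (φ (x, y)) ∂(volI P) := by
    have hη : ContDiff ℝ 1 fun y => φ (x, y) := hφ.comp (contDiff_prodMk_right x)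
    have hderiv (y : ℝ) : deriv (fun y => mode P n x * conj (φ (x, y))) y
        = mode P n x * conj (pd₂ φ (x, y)) :=
      ((hη.differentiable one_ne_zero y).hasDerivAt.star.const_mul (mode P n x)).deriv
    have hparts := hF.integral_mul_deriv (neg_le_self P.H_pos.le)
      (contDiff_const.mul (conjCLE.contDiff.comp hη) : ContDiff ℝ 1 fun y =>
        mode P n x * conj (φ (x, y)))
    simpa only [hderiv, ← mul_assoc] using hparts
  rw [volΩ_eq_prod] at hintF hintf ⊢
  rw [integral_prod _ hintF, integral_prod _ hintf, ← integral_const_mul, ← integral_const_mul,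
    ← integral_sub ((htrace _).const_mul _) ((htrace _).const_mul _)]
  refine Eq.trans ?_ (integral_sub (((htrace _).const_mul _).sub ((htrace _).const_mul _))
    hintf.integral_prod_left)
  exact integral_congr_ae (Eventually.of_forall hline)

lemma H1qp.integral_mul_conj_d₂ (v : H1qp P) (hF : HasL2DerivOn F f (-P.H) P.H) (n : ℤ) :
    ∫ x, F x.2 * mode P n x.1 * conj (v.d₂ x) ∂(volΩ P)
      = P.L * (F P.H * conj (qpCoeff P n v.top) - F (-P.H) * conj (qpCoeff P n v.bot))
        - ∫ x, f x.2 * mode P n x.1 * conj (v.val x) ∂(volΩ P) := by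
  obtain ⟨φ, hφ, hval, -, hd₂, htop, hbot⟩ := v.approx
  have hC1 (k : ℕ) : ContDiff ℝ 1 (φ k) := (hφ k).1.of_le (by simp)
  have htrace (k : ℕ) (y : ℝ) : MemLp (fun x => φ k (x, y)) 2 (volΓ P) :=
    memLp_volΓ_of_continuous ((hC1 k).continuous.comp (by fun_prop))
  have hlim₂ := tendsto_integral_mul_conj_of_tendsto_eLpNorm_two
    (memLp_comp_snd_mul_mode hF.memLp n) v.memLp_d₂
    (fun k => memLp_pd₂ (hC1 k)) hd₂
  have hlim := tendsto_integral_mul_conj_of_tendsto_eLpNorm_two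
    (memLp_comp_snd_mul_mode hF.memLp_deriv n) v.memLp_val
    (fun k => memLp_volΩ_of_continuous (hC1 k).continuous) hval
  have hlimTop := tendsto_integral_mul_conj_of_tendsto_eLpNorm_two (memLp_mode P n) v.memLp_top
    (fun k => htrace k _) htop
  have hlimBot := tendsto_integral_mul_conj_of_tendsto_eLpNorm_two (memLp_mode P n) v.memLp_bot
    (fun k => htrace k _) hbot
  rw [mul_sub, mul_left_comm, L_mul_conj_qpCoeff, mul_left_comm, L_mul_conj_qpCoeff]
  have hlimBdry := (hlimTop.const_mul (F P.H)).sub (hlimBot.const_mul (F (-P.H)))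
  exact tendsto_nhds_unique hlim₂ ((hlimBdry.sub hlim).congr fun k =>
    (integral_mul_conj_pd₂_of_contDiff hF n (hC1 k)).symm)

end Coefficients

section Green

variable {P : Grating} {M : ℕ} {v : H1qp P} {F f : ℤ → ℝ → ℂ}

lemma H1qp.integral_field_mul_conj_d₂ (v : H1qp P)
    (hF : ∀ n ∈ Finset.Icc (-(M : ℤ)) M, HasL2DerivOn (F n) (f n) (-P.H) P.H) :
    ∫ x, field P M F x * conj (v.d₂ x) ∂(volΩ P)
      = P.L * ∑ n ∈ Finset.Icc (-(M : ℤ)) M,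
          (F n P.H * conj (qpCoeff P n v.top) - F n (-P.H) * conj (qpCoeff P n v.bot))
        - ∫ x, field P M f x * conj (v.val x) ∂(volΩ P) := by
  simp only [field, Finset.sum_mul]
  rw [integral_finsetSum _ fun n hn =>
      integrable_mul_conj_of_memLp_two (memLp_comp_snd_mul_mode (hF n hn).memLp n) v.memLp_d₂,
    integral_finsetSum _ fun n hn => integrable_mul_conj_of_memLp_two
      (memLp_comp_snd_mul_mode (hF n hn).memLp_deriv n) v.memLp_val,
    Finset.mul_sum, ← Finset.sum_sub_distrib]
  exact Finset.sum_congr rfl fun n hn => v.integral_mul_conj_d₂ (hF n hn) n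

lemma integral_mul_conj_eq_of_qpCoeff_ae_eq {K K' w : ℝ × ℝ → ℂ} {g : ℤ → ℝ → ℂ}
    (hK : MemLp K 2 (volΩ P)) (hK' : MemLp K' 2 (volΩ P))
    (hg : ∀ n ∈ Finset.Icc (-(M : ℤ)) M, MemLp (g n) 2 (volI P)) (hw : w =ᵐ[volΩ P] field P M g)
    (h : ∀ n ∈ Finset.Icc (-(M : ℤ)) M, ∀ᵐ y ∂(volI P),
      qpCoeff P n (fun x => K (x, y)) = qpCoeff P n (fun x => K' (x, y))) :
    ∫ x, K x * conj (w x) ∂(volΩ P) = ∫ x, K' x * conj (w x) ∂(volΩ P) := by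
  rw [integral_congr_ae (hw.mono fun x hx => congrArg (K x * conj ·) hx),
    integral_congr_ae (hw.mono fun x hx => congrArg (K' x * conj ·) hx),
    integral_mul_conj_field hK hg, integral_mul_conj_field hK' hg]
  congr 1
  refine Finset.sum_congr rfl fun n hn => integral_congr_ae ?_
  filter_upwards [h n hn] with y hy
  rw [hy]

/-- Green's formula for a flux `(K₁, K₂)` of divergence `q`. Of the three functions, test functions
in `V_M` only see the Fourier coefficients with `|n| ≤ M`. -/
lemma integral_conj_gradient_eq_boundary (hv : v ∈ V P M) {K₁ K₂ q : ℝ × ℝ → ℂ}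
    (hK₁ : MemLp K₁ 2 (volΩ P)) (hK₂ : MemLp K₂ 2 (volΩ P)) (hq : MemLp q 2 (volΩ P))
    (hF : ∀ n ∈ Finset.Icc (-(M : ℤ)) M, HasL2DerivOn (F n) (f n) (-P.H) P.H)
    (hK₂F : ∀ n ∈ Finset.Icc (-(M : ℤ)) M, ∀ᵐ y ∂(volI P), qpCoeff P n (fun x => K₂ (x, y)) = F n y)
    (hdiv : ∀ n ∈ Finset.Icc (-(M : ℤ)) M, ∀ᵐ y ∂(volI P),
      I * α P n * qpCoeff P n (fun x => K₁ (x, y)) + f n y = qpCoeff P n (fun x => q (x, y))) :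
    ∫ x, K₁ x * conj (v.d₁ x) ∂(volΩ P) + ∫ x, K₂ x * conj (v.d₂ x) ∂(volΩ P)
        + ∫ x, q x * conj (v.val x) ∂(volΩ P)
      = P.L * ∑ n ∈ Finset.Icc (-(M : ℤ)) M,
          (F n P.H * conj (qpCoeff P n v.top) - F n (-P.H) * conj (qpCoeff P n v.bot)) := by
  obtain ⟨ξ, ξ', hξ, hξ', hval, hd₁, hd₂⟩ := exists_gradient_ae_eq_field_of_mem_V hv
  have hmf : MemLp (field P M f) 2 (volΩ P) := memLp_field fun n hn => (hF n hn).memLp_deriv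
  have hflux : ∫ x, K₂ x * conj (v.d₂ x) ∂(volΩ P) = ∫ x, field P M F x * conj (v.d₂ x) ∂(volΩ P) :=
    integral_mul_conj_eq_of_qpCoeff_ae_eq hK₂ (memLp_field fun n hn => (hF n hn).memLp) hξ' hd₂
      fun n hn => (hK₂F n hn).mono fun y hy => by rw [hy, qpCoeff_field F hn]
  have htangential : ∫ x, K₁ x * conj (v.d₁ x) ∂(volΩ P)
      = ∫ x, field P M f x * conj (v.val x) ∂(volΩ P) - ∫ x, q x * conj (v.val x) ∂(volΩ P) := by
    rw [integral_congr_ae (hd₁.mono fun x hx => congrArg (K₁ x * conj ·) hx),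
      integral_congr_ae (hval.mono fun x hx => congrArg (field P M f x * conj ·) hx),
      integral_congr_ae (hval.mono fun x hx => congrArg (q x * conj ·) hx),
      integral_mul_conj_field hK₁ fun n hn => (hξ n hn).const_mul _,
      integral_mul_conj_field hmf hξ, integral_mul_conj_field hq hξ, ← mul_sub,
      ← Finset.sum_sub_distrib]
    congr 1
    refine Finset.sum_congr rfl fun n hn => ?_
    rw [← integral_sub (integrable_qpCoeff_mul_conj hmf (hξ n hn) n)
      (integrable_qpCoeff_mul_conj hq (hξ n hn) n)]
    refine integral_congr_ae ((hdiv n hn).mono fun y hy => ?_)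
    simp only [qpCoeff_field f hn, ← hy, map_mul, conj_I, conj_ofReal]
    ring
  rw [hflux, v.integral_field_mul_conj_d₂ hF, htangential]
  ring

end Green

section Slices

variable {P : Grating} {T : Mesh P} {M : ℕ}

lemma exists_norm_one_div_ε_le (P : Grating) : ∃ C, ∀ x, ‖1 / P.ε x‖ ≤ C := by
  obtain ⟨c, hc, hre⟩ := P.re_ε
  refine ⟨1 / c, fun x => ?_⟩
  rw [norm_div, norm_one]
  exact one_div_le_one_div_of_le hc ((hre x).trans (re_le_norm _))

lemma Mesh.measurable_sliceε (j : ℕ) : Measurable (T.sliceε j) :=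
  P.measurable_ε.comp (by fun_prop)

lemma Mesh.measurable_εh : Measurable T.εh :=
  Finset.measurable_fun_sum _ fun j _ => Measurable.ite (measurable_snd measurableSet_Ioo)
    ((T.measurable_sliceε j).comp measurable_fst) measurable_const

lemma Mesh.εh_eq_sliceε {j : ℕ} (hj : j < T.S) {x₁ x₂ : ℝ}
    (hx : x₂ ∈ Set.Ioo (T.node j) (T.node (j + 1))) : T.εh (x₁, x₂) = T.sliceε j x₁ := by
  rw [Mesh.εh, Finset.sum_eq_single_of_mem j (Finset.mem_range.2 hj), if_pos hx]
  intro i hi hij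
  exact if_neg fun hxi => hij <| T.eq_of_mem_Ioo_node_of_mem_Icc_node (Finset.mem_range.1 hi) hj hxi
    (Set.Ioo_subset_Icc_self hx)

lemma memLp_one_div_εh_mul {f : ℝ × ℝ → ℂ} (hf : MemLp f 2 (volΩ P)) :
    MemLp (fun x => 1 / T.εh x * f x) 2 (volΩ P) := by
  obtain ⟨C, hC⟩ := exists_norm_one_div_ε_le P
  refine hf.of_le_mul (c := C)
    ((T.measurable_εh.const_div 1).aestronglyMeasurable.mul hf.1) ?_
  have hslice : ∀ᵐ x ∂(volΩ P), ∃ j < T.S, x.2 ∈ Set.Ioo (T.node j) (T.node (j + 1)) := by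
    rw [volΩ_eq_prod]
    exact Measure.quasiMeasurePreserving_snd.ae T.ae_exists_mem_Ioo_node
  filter_upwards [hslice] with x ⟨j, hj, hx⟩
  rw [← Prod.mk.eta (p := x), T.εh_eq_sliceε hj hx, norm_mul]
  exact mul_le_mul_of_nonneg_right (hC _) (norm_nonneg _)

lemma memLp_one_div_sliceε_mul {f : ℝ → ℂ} (hf : MemLp f 2 (volΓ P)) (j : ℕ) :
    MemLp (fun x => 1 / T.sliceε j x * f x) 2 (volΓ P) := by
  obtain ⟨C, hC⟩ := exists_norm_one_div_ε_le P
  refine hf.of_le_mul (c := C)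
    (((T.measurable_sliceε j).const_div 1).aestronglyMeasurable.mul hf.1)
    (Eventually.of_forall fun x => ?_)
  rw [norm_mul]
  exact mul_le_mul_of_nonneg_right (hC _) (norm_nonneg _)

variable (T M) in
/-- The `n`-th coefficient of `ε_h⁻¹ ∑_{|m| ≤ M} a_m exp(i α_m x₁)` in slice `j`, given by Laurent's
rule. -/
def Mesh.laurent (j : ℕ) (a : ℤ → ℂ) (n : ℤ) : ℂ :=
  ∑ m ∈ Finset.Icc (-(M : ℤ)) M, T.invεCoeff j (n - m) * a m

lemma Mesh.laurent_congr {j : ℕ} {a b : ℤ → ℂ} (n : ℤ)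
    (h : ∀ m ∈ Finset.Icc (-(M : ℤ)) M, a m = b m) : T.laurent M j a n = T.laurent M j b n :=
  Finset.sum_congr rfl fun m hm => by rw [h m hm]

lemma Mesh.laurent_add (j : ℕ) (a b : ℤ → ℂ) (n : ℤ) :
    T.laurent M j (fun m => a m + b m) n = T.laurent M j a n + T.laurent M j b n := by
  simp only [Mesh.laurent, mul_add, Finset.sum_add_distrib]

lemma Mesh.laurent_const_mul (j : ℕ) (c : ℂ) (a : ℤ → ℂ) (n : ℤ) :
    T.laurent M j (fun m => c * a m) n = c * T.laurent M j a n := by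
  simp only [Mesh.laurent, Finset.mul_sum, mul_left_comm c]

lemma Mesh.hasDerivAt_laurent {g : ℤ → ℝ → ℂ} {g' : ℤ → ℂ} {y : ℝ} (j : ℕ) (n : ℤ)
    (hg : ∀ m ∈ Finset.Icc (-(M : ℤ)) M, HasDerivAt (g m) (g' m) y) :
    HasDerivAt (fun x => T.laurent M j (fun m => g m x) n) (T.laurent M j g' n) y :=
  HasDerivAt.fun_sum fun m hm => (hg m hm).const_mul _

lemma Mesh.qpCoeff_one_div_sliceε_mul_mode (j : ℕ) (m n : ℤ) :
    qpCoeff P n (fun x => 1 / T.sliceε j x * mode P m x) = T.invεCoeff j (n - m) := by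
  simp only [qpCoeff, Mesh.invεCoeff, ← conj_mode, mul_assoc (1 / T.sliceε j _),
    mode_mul_conj_mode]

lemma Mesh.qpCoeff_one_div_sliceε_mul_field (j : ℕ) (g : ℤ → ℝ → ℂ) (n : ℤ) (y : ℝ) :
    qpCoeff P n (fun x => 1 / T.sliceε j x * field P M g (x, y))
      = T.laurent M j (fun m => g m y) n := by
  simp only [field, Finset.mul_sum]
  rw [qpCoeff_sum n fun m _ => memLp_one_div_sliceε_mul ((memLp_mode P m).const_mul (g m y)) j]
  refine Finset.sum_congr rfl fun m _ => ?_
  simp only [mul_left_comm (1 / T.sliceε j _)]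
  rw [qpCoeff_const_mul, T.qpCoeff_one_div_sliceε_mul_mode, mul_comm]

lemma Mesh.qpCoeff_contrast_mul_field (j : ℕ) (g : ℤ → ℝ → ℂ) {n : ℤ}
    (hn : n ∈ Finset.Icc (-(M : ℤ)) M) (y : ℝ) :
    qpCoeff P n (fun x => (1 / (P.εp : ℂ) - 1 / T.sliceε j x) * field P M g (x, y))
      = 1 / (P.εp : ℂ) * g n y - T.laurent M j (fun m => g m y) n := by
  simp only [sub_mul]
  rw [qpCoeff_sub n ((memLp_field_trace g y).const_mul _)
      (memLp_one_div_sliceε_mul (memLp_field_trace g y) j),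
    qpCoeff_const_mul, T.qpCoeff_one_div_sliceε_mul_field, qpCoeff_field g hn]

variable (T) in
/-- A component of the flux `ε_h⁻¹ ∇u - (ε₊⁻¹ - ε_h⁻¹) ∇u^inc = ε_h⁻¹ ∇(u + u^inc) - ε₊⁻¹ ∇u^inc`
paired with `∇v` in `B(u, v) - f(v)`; `w`, `w'` are the components of `∇u`, `∇u^inc`. -/
def Mesh.scatteredFlux (w w' : ℝ × ℝ → ℂ) (x : ℝ × ℝ) : ℂ :=
  1 / T.εh x * w x - (1 / (P.εp : ℂ) - 1 / T.εh x) * w' x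

lemma memLp_contrast_mul {f : ℝ × ℝ → ℂ} (hf : MemLp f 2 (volΩ P)) :
    MemLp (fun x => (1 / (P.εp : ℂ) - 1 / T.εh x) * f x) 2 (volΩ P) := by
  simp only [sub_mul]
  exact (hf.const_mul _).sub (memLp_one_div_εh_mul hf)

lemma Mesh.memLp_scatteredFlux {w w' : ℝ × ℝ → ℂ} (hw : MemLp w 2 (volΩ P))
    (hw' : MemLp w' 2 (volΩ P)) : MemLp (T.scatteredFlux w w') 2 (volΩ P) :=
  (memLp_one_div_εh_mul hw).sub (memLp_contrast_mul hw')

lemma Mesh.qpCoeff_scatteredFlux_field (g g' : ℤ → ℝ → ℂ) {n : ℤ}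
    (hn : n ∈ Finset.Icc (-(M : ℤ)) M) {j : ℕ} (hj : j < T.S) {y : ℝ}
    (hy : y ∈ Set.Ioo (T.node j) (T.node (j + 1))) :
    qpCoeff P n (fun x => T.scatteredFlux (field P M g) (field P M g') (x, y))
      = T.laurent M j (fun m => g m y + g' m y) n - 1 / (P.εp : ℂ) * g' n y := by
  simp only [Mesh.scatteredFlux, T.εh_eq_sliceε hj hy]
  have hcontrast : MemLp (fun x => (1 / (P.εp : ℂ) - 1 / T.sliceε j x) * field P M g' (x, y)) 2
      (volΓ P) := by
    simp only [sub_mul]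
    exact ((memLp_field_trace g' y).const_mul _).sub
      (memLp_one_div_sliceε_mul (memLp_field_trace g' y) j)
  rw [qpCoeff_sub n (memLp_one_div_sliceε_mul (memLp_field_trace g y) j) hcontrast,
    T.qpCoeff_one_div_sliceε_mul_field, T.qpCoeff_contrast_mul_field j g' hn, T.laurent_add]
  ring

end Slices

section Incident

variable {P : Grating} {T : Mesh P} {M : ℕ}

lemma contDiff_incCoeff (n : ℤ) : ContDiff ℝ ∞ (incCoeff P n) := by
  unfold incCoeff
  split_ifs
  · have hcoe : ContDiff ℝ ∞ (fun y : ℝ => (y : ℂ)) := ofRealCLM.contDiff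
    exact (contDiff_const.mul hcoe).neg.cexp
  · exact contDiff_const

lemma contDiff_deriv_incCoeff (n : ℤ) : ContDiff ℝ ∞ (deriv (incCoeff P n)) :=
  (contDiff_infty_iff_deriv.1 (contDiff_incCoeff n)).2

lemma hasDerivAt_deriv_incCoeff (n : ℤ) (y : ℝ) :
    HasDerivAt (deriv (incCoeff P n)) (deriv (deriv (incCoeff P n)) y) y :=
  ((contDiff_deriv_incCoeff n).differentiable (by simp) y).hasDerivAt

lemma uinc_eq_field (M : ℕ) : uinc P = field P M (incCoeff P) := by
  ext x
  rw [field, Finset.sum_eq_single 0 (fun m _ hm => by simp [incCoeff, hm]) (by simp)]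
  simp only [uinc, incCoeff, mode, α, if_true]
  rw [← exp_add]
  congr 1
  push_cast
  ring

lemma pd₁_uinc (M : ℕ) :
    pd₁ (uinc P) = field P M (fun n x₂ => I * α P n * incCoeff P n x₂) := by
  rw [uinc_eq_field M, pd₁_field]

lemma pd₂_uinc (M : ℕ) : pd₂ (uinc P) = field P M (fun n => deriv (incCoeff P n)) := by
  rw [uinc_eq_field M, pd₂_field fun n _ => (contDiff_incCoeff n).differentiable (by simp)]

variable (P) in
lemma contDiff_uinc : ContDiff ℝ 1 (uinc P) := by
  rw [uinc_eq_field 0]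
  exact (isSmoothQP_field fun n _ => contDiff_incCoeff n).1.of_le (by simp)

lemma Mesh.sourceCoeff_eq (j : ℕ) {n : ℤ} (hn : n ∈ Finset.Icc (-(M : ℤ)) M) (y : ℝ) :
    T.sourceCoeff j n y
      = I * α P n * (1 / (P.εp : ℂ) * (I * α P n * incCoeff P n y)
          - T.laurent M j (fun m => I * α P m * incCoeff P m y) n)
        + (1 / (P.εp : ℂ) * deriv (deriv (incCoeff P n)) y
          - T.laurent M j (fun m => deriv (deriv (incCoeff P m)) y) n) := by
  simp only [Mesh.sourceCoeff, pd₁_uinc M, pd₂_uinc M, T.qpCoeff_contrast_mul_field j _ hn]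
  congr 1
  exact (((hasDerivAt_deriv_incCoeff n y).const_mul _).sub
    (T.hasDerivAt_laurent j n fun m _ => hasDerivAt_deriv_incCoeff m y)).deriv

end Incident

section Solution

variable {P : Grating} {T : Mesh P} {M : ℕ} {u : ℤ → ℝ → ℂ} {r t : ℤ → ℂ}

variable (T M) in
/-- The `n`-th coefficient of the second component of the flux
`ε_h⁻¹ ∇(u + u^inc) - ε₊⁻¹ ∇u^inc` in slice `j`. -/
def Mesh.scatteredFluxCoeff (u : ℤ → ℝ → ℂ) (j : ℕ) (n : ℤ) (y : ℝ) : ℂ :=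
  T.totalFlux M u j n y - 1 / (P.εp : ℂ) * deriv (incCoeff P n) y

namespace Mesh.IsSolution

lemma hasL2DerivOn (hu : T.IsSolution M u r t) {n : ℤ} (hn : n ∈ Finset.Icc (-(M : ℤ)) M) :
    HasL2DerivOn (u n) (deriv (u n)) (-P.H) P.H :=
  T.hasL2DerivOn fun j hj =>
    HasL2DerivOn.of_contDiffOn ((hu.contDiffOn n hn j hj).of_le one_le_two)

lemma contDiffOn_scatteredFluxCoeff (hu : T.IsSolution M u r t) (n : ℤ) {j : ℕ} (hj : j < T.S) :
    ContDiffOn ℝ 1 (T.scatteredFluxCoeff M u j n) (Set.Icc (T.node j) (T.node (j + 1))) := by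
  refine ContDiffOn.sub (ContDiffOn.sum fun m hm => contDiffOn_const.mul ?_)
    (contDiff_const.mul ((contDiff_deriv_incCoeff n).of_le (by simp))).contDiffOn
  exact ((hu.contDiffOn m hm j hj).add
    (contDiff_infty.1 (contDiff_incCoeff m) 2).contDiffOn).derivWithin
    (uniqueDiffOn_Icc (T.node_lt j hj)) one_add_one_eq_two.le

lemma exists_hasL2DerivOn_scatteredFluxCoeff (hu : T.IsSolution M u r t) {n : ℤ}
    (hn : n ∈ Finset.Icc (-(M : ℤ)) M) :
    ∃ F, HasL2DerivOn F (deriv F) (-P.H) P.H ∧ ∀ j < T.S,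
      Set.EqOn F (T.scatteredFluxCoeff M u j n) (Set.Icc (T.node j) (T.node (j + 1))) := by
  obtain ⟨F, hF⟩ := T.exists_eqOn_slices (f := fun j => T.scatteredFluxCoeff M u j n)
    fun j hj => congrArg (· - _) (hu.flux n hn j hj)
  refine ⟨F, T.hasL2DerivOn fun j hj => HasL2DerivOn.of_contDiffOn ?_, fun j hj => (hF j hj).symm⟩
  exact (hu.contDiffOn_scatteredFluxCoeff n hj).congr (hF j hj).symm

section Slice

variable {j : ℕ} {y : ℝ}

lemma scatteredFluxCoeff_eq (hu : T.IsSolution M u r t) (n : ℤ) (hj : j < T.S)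
    (hy : y ∈ Set.Ioo (T.node j) (T.node (j + 1))) :
    T.scatteredFluxCoeff M u j n y
      = T.laurent M j (fun m => deriv (u m) y + deriv (incCoeff P m) y) n
        - 1 / (P.εp : ℂ) * deriv (incCoeff P n) y := by
  have hnhds := Icc_mem_nhds hy.1 hy.2
  refine congrArg (· - _) (T.laurent_congr n fun m hm => ?_)
  rw [derivWithin_of_mem_nhds hnhds]
  exact deriv_fun_add
    (((hu.contDiffOn m hm j hj).differentiableOn two_ne_zero).differentiableAt hnhds)
    ((contDiff_incCoeff m).differentiable (by simp) y)

lemma deriv_scatteredFluxCoeff (hu : T.IsSolution M u r t) (n : ℤ) (hj : j < T.S)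
    (hy : y ∈ Set.Ioo (T.node j) (T.node (j + 1))) :
    deriv (T.scatteredFluxCoeff M u j n) y
      = T.laurent M j (fun m => deriv (deriv (u m)) y + deriv (deriv (incCoeff P m)) y) n
        - 1 / (P.εp : ℂ) * deriv (deriv (incCoeff P n)) y := by
  have hnhds := Ioo_mem_nhds hy.1 hy.2
  have hu' (m : ℤ) (hm : m ∈ Finset.Icc (-(M : ℤ)) M) :
      HasDerivAt (deriv (u m)) (deriv (deriv (u m)) y) y :=
    (((((hu.contDiffOn m hm j hj).mono Set.Ioo_subset_Icc_self).deriv_of_isOpen (m := 1)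
      isOpen_Ioo one_add_one_eq_two.le).differentiableOn one_ne_zero).differentiableAt
        hnhds).hasDerivAt
  have heq := eventually_of_mem hnhds fun z hz => hu.scatteredFluxCoeff_eq n hj hz
  rw [EventuallyEq.deriv_eq heq]
  exact ((T.hasDerivAt_laurent j n fun m hm => (hu' m hm).add (hasDerivAt_deriv_incCoeff m y)).sub
    ((hasDerivAt_deriv_incCoeff n y).const_mul _)).deriv

lemma ode_divergence_form (hu : T.IsSolution M u r t) {n : ℤ} (hn : n ∈ Finset.Icc (-(M : ℤ)) M)
    (hj : j < T.S) (hy : y ∈ Set.Ioo (T.node j) (T.node (j + 1))) :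
    I * α P n * (T.laurent M j (fun m => I * α P m * u m y + I * α P m * incCoeff P m y) n
        - 1 / (P.εp : ℂ) * (I * α P n * incCoeff P n y))
      + deriv (T.scatteredFluxCoeff M u j n) y = -(P.κ : ℂ) ^ 2 * u n y := by
  have hode : T.laurent M j (fun m => deriv (deriv (u m)) y) n
      = α P n * T.laurent M j (fun m => α P m * u m y) n - (P.κ : ℂ) ^ 2 * u n y
        + T.sourceCoeff j n y := hu.ode n hn j hj y hy
  rw [T.sourceCoeff_eq j hn] at hode
  have hI : T.laurent M j (fun m => I * α P m * u m y) n
      = I * T.laurent M j (fun m => α P m * u m y) n := by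
    simp only [← T.laurent_const_mul, mul_assoc]
  rw [hu.deriv_scatteredFluxCoeff n hj hy, T.laurent_add, T.laurent_add, hode, hI]
  linear_combination α P n * T.laurent M j (fun m => α P m * u m y) n * I_mul_I

end Slice

lemma scatteredFluxCoeff_top (hu : T.IsSolution M u r t) {n : ℤ}
    (hn : n ∈ Finset.Icc (-(M : ℤ)) M) :
    T.scatteredFluxCoeff M u (T.S - 1) n P.H = I / P.εp * β P P.εp n * u n P.H := by
  rw [scatteredFluxCoeff, hu.top_flux n hn]
  linear_combination -(I / P.εp * β P P.εp n) * hu.top_val n hn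

lemma scatteredFluxCoeff_bot (hu : T.IsSolution M u r t) {n : ℤ}
    (hn : n ∈ Finset.Icc (-(M : ℤ)) M) :
    T.scatteredFluxCoeff M u 0 n (-P.H)
      = -((1 / (P.εp : ℂ) - 1 / (P.εm : ℂ)) * deriv (incCoeff P n) (-P.H))
        - I / P.εm * β P P.εm n * u n (-P.H) := by
  rw [scatteredFluxCoeff, hu.bot_flux n hn]
  linear_combination (I / P.εm * β P P.εm n) * hu.bot_val n hn

end Mesh.IsSolution

lemma dtnPairing_field (u : ℤ → ℝ → ℂ) (e y : ℝ) (ψ : ℝ → ℂ) :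
    dtnPairing P e (fun x => field P M u (x, y)) ψ
      = P.L * ∑ n ∈ Finset.Icc (-(M : ℤ)) M, I / e * β P e n * u n y * conj (qpCoeff P n ψ) := by
  rw [dtnPairing, tsum_eq_sum (s := Finset.Icc (-(M : ℤ)) M)]
  · congr 1
    refine Finset.sum_congr rfl fun n hn => ?_
    rw [qpCoeff_field u hn]
  · intro n hn
    rw [qpCoeff_field_of_notMem u hn, mul_zero, zero_mul]

lemma integral_field_mul_conj (g : ℤ → ℝ → ℂ) (y : ℝ) {ψ : ℝ → ℂ} (hψ : MemLp ψ 2 (volΓ P)) :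
    ∫ x, field P M g (x, y) * conj (ψ x) ∂(volΓ P)
      = P.L * ∑ n ∈ Finset.Icc (-(M : ℤ)) M, g n y * conj (qpCoeff P n ψ) := by
  simp only [field, Finset.sum_mul, Finset.mul_sum]
  rw [integral_finsetSum _ fun n _ =>
    integrable_mul_conj_of_memLp_two ((memLp_mode P n).const_mul (g n y)) hψ]
  refine Finset.sum_congr rfl fun n _ => ?_
  rw [mul_left_comm, L_mul_conj_qpCoeff, ← integral_const_mul]
  simp only [mul_assoc]

lemma H1qp.integrable_contrast_mul (v : H1qp P) {w₁ w₂ : ℝ × ℝ → ℂ} (hw₁ : MemLp w₁ 2 (volΩ P))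
    (hw₂ : MemLp w₂ 2 (volΩ P)) :
    Integrable (fun x => (1 / (P.εp : ℂ) - 1 / T.εh x) *
      (w₁ x * conj (v.d₁ x) + w₂ x * conj (v.d₂ x))) (volΩ P) := by
  simp only [mul_add, ← mul_assoc]
  exact (integrable_mul_conj_of_memLp_two (memLp_contrast_mul hw₁) v.memLp_d₁).add
    (integrable_mul_conj_of_memLp_two (memLp_contrast_mul hw₂) v.memLp_d₂)

lemma B_sub_source_eq (U v : H1qp P) :
    B P T.εh U v - source P T.εh v
      = ∫ x, T.scatteredFlux U.d₁ (pd₁ (uinc P)) x * conj (v.d₁ x) ∂(volΩ P)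
        + ∫ x, T.scatteredFlux U.d₂ (pd₂ (uinc P)) x * conj (v.d₂ x) ∂(volΩ P)
        + ∫ x, -(P.κ : ℂ) ^ 2 * U.val x * conj (v.val x) ∂(volΩ P)
        - dtnPairing P P.εm U.bot v.bot - dtnPairing P P.εp U.top v.top
        - ∫ x, (1 / (P.εp : ℂ) - 1 / (P.εm : ℂ)) * pd₂ (uinc P) (x, -P.H) * conj (v.bot x)
            ∂(volΓ P) := by
  have hinc₁ : MemLp (pd₁ (uinc P)) 2 (volΩ P) := memLp_pd₁ (contDiff_uinc P)
  have hinc₂ : MemLp (pd₂ (uinc P)) 2 (volΩ P) := memLp_pd₂ (contDiff_uinc P)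
  have hint₁ := integrable_mul_conj_of_memLp_two
    (T.memLp_scatteredFlux U.memLp_d₁ hinc₁) v.memLp_d₁
  have hint₂ := integrable_mul_conj_of_memLp_two
    (T.memLp_scatteredFlux U.memLp_d₂ hinc₂) v.memLp_d₂
  have hint₀ := integrable_mul_conj_of_memLp_two
    (U.memLp_val.const_mul (-(P.κ : ℂ) ^ 2)) v.memLp_val
  have hvolume : ∫ x, ((1 / T.εh x) * (U.d₁ x * conj (v.d₁ x) + U.d₂ x * conj (v.d₂ x))
        - (P.κ : ℂ) ^ 2 * (U.val x * conj (v.val x))) ∂(volΩ P)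
      = ∫ x, T.scatteredFlux U.d₁ (pd₁ (uinc P)) x * conj (v.d₁ x) ∂(volΩ P)
        + ∫ x, T.scatteredFlux U.d₂ (pd₂ (uinc P)) x * conj (v.d₂ x) ∂(volΩ P)
        + ∫ x, -(P.κ : ℂ) ^ 2 * U.val x * conj (v.val x) ∂(volΩ P)
        + ∫ x, (1 / (P.εp : ℂ) - 1 / T.εh x) *
            (pd₁ (uinc P) x * conj (v.d₁ x) + pd₂ (uinc P) x * conj (v.d₂ x)) ∂(volΩ P) := by
    rw [← integral_add hint₁ hint₂]
    refine Eq.trans ?_ (congrArg (· + _) (integral_add (hint₁.add hint₂) hint₀))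
    refine Eq.trans ?_ (integral_add ((hint₁.add hint₂).add hint₀)
      (v.integrable_contrast_mul hinc₁ hinc₂))
    refine congrArg (integral (volΩ P)) (funext fun x => ?_)
    simp only [Mesh.scatteredFlux]
    ring
  simp only [volΩ] at hvolume
  rw [B, source, hvolume]
  simp only [volΩ, volΓ, sub_self, zero_mul, integral_zero]
  ring

namespace Mesh.IsSolution

lemma integral_scatteredFlux_conj_gradient (hu : T.IsSolution M u r t) {v : H1qp P}
    (hv : v ∈ V P M) :
    ∫ x, T.scatteredFlux (field P M fun n x₂ => I * α P n * u n x₂) (pd₁ (uinc P)) x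
          * conj (v.d₁ x) ∂(volΩ P)
        + ∫ x, T.scatteredFlux (field P M fun n => deriv (u n)) (pd₂ (uinc P)) x
          * conj (v.d₂ x) ∂(volΩ P)
        + ∫ x, -(P.κ : ℂ) ^ 2 * field P M u x * conj (v.val x) ∂(volΩ P)
      = P.L * ∑ n ∈ Finset.Icc (-(M : ℤ)) M,
          (I / P.εp * β P P.εp n * u n P.H * conj (qpCoeff P n v.top)
            - (-((1 / (P.εp : ℂ) - 1 / (P.εm : ℂ)) * deriv (incCoeff P n) (-P.H))
                - I / P.εm * β P P.εm n * u n (-P.H)) * conj (qpCoeff P n v.bot)) := by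
  choose! F hF hFeq using fun n hn => hu.exists_hasL2DerivOn_scatteredFluxCoeff (n := n) hn
  have htop (n : ℤ) (hn : n ∈ Finset.Icc (-(M : ℤ)) M) :=
    (hFeq n hn _ T.pred_S_lt T.H_mem_Icc_node).trans (hu.scatteredFluxCoeff_top hn)
  have hbot (n : ℤ) (hn : n ∈ Finset.Icc (-(M : ℤ)) M) :=
    (hFeq n hn _ T.S_pos T.neg_H_mem_Icc_node).trans (hu.scatteredFluxCoeff_bot hn)
  rw [integral_conj_gradient_eq_boundary hv
    (T.memLp_scatteredFlux (memLp_field fun n hn => (hu.hasL2DerivOn hn).memLp.const_mul _)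
      (memLp_pd₁ (contDiff_uinc P)))
    (T.memLp_scatteredFlux (memLp_field fun n hn => (hu.hasL2DerivOn hn).memLp_deriv)
      (memLp_pd₂ (contDiff_uinc P)))
    ((memLp_field fun n hn => (hu.hasL2DerivOn hn).memLp).const_mul _) hF]
  · congr 1
    exact Finset.sum_congr rfl fun n hn => by rw [htop n hn, hbot n hn]
  · intro n hn
    filter_upwards [T.ae_exists_mem_Ioo_node] with y ⟨j, hj, hy⟩
    rw [pd₂_uinc M, T.qpCoeff_scatteredFlux_field _ _ hn hj hy,
      hFeq n hn j hj (Set.Ioo_subset_Icc_self hy), hu.scatteredFluxCoeff_eq n hj hy]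
  · intro n hn
    filter_upwards [T.ae_exists_mem_Ioo_node] with y ⟨j, hj, hy⟩
    have hderiv : deriv (F n) y = deriv (T.scatteredFluxCoeff M u j n) y :=
      ((hFeq n hn j hj).eventuallyEq_of_mem (Icc_mem_nhds hy.1 hy.2)).deriv_eq
    rw [pd₁_uinc M, T.qpCoeff_scatteredFlux_field _ _ hn hj hy, hderiv,
      hu.ode_divergence_form hn hj hy, qpCoeff_const_mul, qpCoeff_field u hn]

theorem B_eq_source (hu : T.IsSolution M u r t) {v : H1qp P} (hv : v ∈ V P M) :
    B P T.εh (H1qp.ofField M u (fun n => deriv (u n)) fun _ hn => hu.hasL2DerivOn hn) v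
      = source P T.εh v := by
  have hsource : ∫ x, (1 / (P.εp : ℂ) - 1 / (P.εm : ℂ)) * pd₂ (uinc P) (x, -P.H)
        * conj (v.bot x) ∂(volΓ P)
      = (1 / (P.εp : ℂ) - 1 / (P.εm : ℂ)) * (P.L * ∑ n ∈ Finset.Icc (-(M : ℤ)) M,
          deriv (incCoeff P n) (-P.H) * conj (qpCoeff P n v.bot)) := by
    rw [← integral_field_mul_conj _ _ v.memLp_bot, pd₂_uinc M, ← integral_const_mul]
    simp only [mul_assoc]
  rw [← sub_eq_zero, B_sub_source_eq, hsource]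
  simp only [H1qp.ofField]
  rw [hu.integral_scatteredFlux_conj_gradient hv, dtnPairing_field, dtnPairing_field]
  simp only [Finset.mul_sum, ← Finset.sum_sub_distrib]
  refine Finset.sum_eq_zero fun n _ => ?_
  ring

end Mesh.IsSolution

end Solution

end RCWA

end

theorem theorem7 (P : RCWA.Grating) (T : RCWA.Mesh P) (M : ℕ)
    (u : ℤ → ℝ → ℂ) (r t : ℤ → ℂ) (hu : T.IsSolution M u r t) :
    ∃ U : RCWA.H1qp P, U.val = RCWA.field P M u ∧ U ∈ RCWA.V P M ∧
      ∀ v ∈ RCWA.V P M, RCWA.B P T.εh U v = RCWA.source P T.εh v := by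
  refine ⟨RCWA.H1qp.ofField M u (fun n => deriv (u n)) fun _ hn => hu.hasL2DerivOn hn, rfl, ?_,
    fun v hv => hu.B_eq_source hv⟩
  exact RCWA.mem_V_iff.2 ⟨u, fun n hn => (hu.hasL2DerivOn hn).memH1Interval, EventuallyEq.rfl⟩
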